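/- Theorem 3.6 (Theorem B). Equip $\mathbb{C}^n$ with its standard hermitian metric $h$, the symplectic form $\omega=\operatorname{Im} h$ and the holomorphic volume form $\Omega=dz_1\wedge\cdots\wedge dz_n$. A special Lagrangian $n$-plane in $\mathbb{C}^n$ is a real linear subspace $V\subset\mathbb{C}^n$ with $\dim_{\mathbb{R}}V=n$ such that $\omega$ and $\operatorname{Im}\Omega$ vanish on $V$. Let $\mathrm{SLG}(n)$ be the set of all such planes, with the subspace topology of the Grassmannian of real $n$-planes in $\mathbb{C}^n$. Let $$M_0(n)=\{(V,V')\in \mathrm{SLG}(n)\times \mathrm{SLG}(n)\;:\;V\cap V'=\{0\}\}$$ with the subspace topology, and let $\tilde M_0(n)=M_0(n)/\mathbb{Z}_2$ be its quotient by the involution $(V,V')\mapsto(V',V)$, with the quotient topology. Then: 1. $M_0(3)$ has exactly two connected components, and each of them is simply-connected; 2. $\tilde M_0(3)$ is connected and simply-connected. -/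

import Mathlib

noncomputable section

/-- `ℂⁿ` with its standard hermitian structure (and the induced real euclidean structure). -/
abbrev Cn (n : ℕ) : Type := EuclideanSpace ℂ (Fin n)

/-- The standard symplectic form `ω = Im h` on `ℂⁿ`, where `h` is the standard hermitian metric. -/
def stdOmega (n : ℕ) (u v : Cn n) : ℝ := (inner ℂ u v).im

/-- The standard holomorphic volume form `Ω = dz₁ ∧ ⋯ ∧ dzₙ` on `ℂⁿ`. -/
def stdVolume (n : ℕ) (v : Fin n → Cn n) : ℂ := Matrix.det (Matrix.of fun i j => v i j)

/-- A special Lagrangian `n`-plane in `ℂⁿ`: a real linear subspace of real dimension `n`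
on which `ω` and `Im Ω` vanish. -/
structure IsSpecialLagrangian {n : ℕ} (V : Submodule ℝ (Cn n)) : Prop where
  finrank_eq : Module.finrank ℝ V = n
  omega_eq_zero : ∀ u ∈ V, ∀ v ∈ V, stdOmega n u v = 0
  im_volume_eq_zero : ∀ v : Fin n → Cn n, (∀ i, v i ∈ V) → (stdVolume n v).im = 0

/-- The Grassmannian `SLG(n)` of (unoriented) special Lagrangian `n`-planes in `ℂⁿ`. -/
def SLG (n : ℕ) : Type := {V : Submodule ℝ (Cn n) // IsSpecialLagrangian V}

/-- The usual topology of the real Grassmannian, restricted to `SLG(n)`: it is induced by the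
embedding that sends a plane to the orthogonal projection onto it, an element of the
finite-dimensional space of real linear endomorphisms of `ℂⁿ`. -/
instance SLG.instTopologicalSpace (n : ℕ) : TopologicalSpace (SLG n) :=
  TopologicalSpace.induced (fun V : SLG n => (V.1.starProjection : Cn n →L[ℝ] Cn n)) inferInstance

/-- The space `M₀(n)` of ordered pairs of special Lagrangian `n`-planes `V`, `V'` in `ℂⁿ` with
`V ∩ V' = {0}`, with the subspace topology from `SLG(n) × SLG(n)`. -/
abbrev M0 (n : ℕ) : Type := {p : SLG n × SLG n // p.1.1 ⊓ p.2.1 = ⊥}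

/-- The involution `(V, V') ↦ (V', V)` of `M₀(n)`. -/
def M0.swap {n : ℕ} (p : M0 n) : M0 n := ⟨(p.1.2, p.1.1), by rw [inf_comm]; exact p.2⟩

/-- Two ordered pairs are identified when they are equal up to the interchange of the two planes. -/
def M0.swapSetoid (n : ℕ) : Setoid (M0 n) where
  r p q := p = q ∨ p = q.swap
  iseqv :=
    { refl := fun _ => Or.inl rfl
      symm := by
        rintro p q (rfl | rfl)
        · exact Or.inl rfl
        · exact Or.inr rfl
      trans := by
        rintro p q r (rfl | rfl) (rfl | rfl)
        · exact Or.inl rfl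
        · exact Or.inr rfl
        · exact Or.inr rfl
        · exact Or.inl rfl }

/-- The quotient `M₀(n) / ℤ₂`, the space of unordered pairs of transverse special Lagrangian
`n`-planes in `ℂⁿ`, with the quotient topology. -/
abbrev M0Tilde (n : ℕ) : Type := Quotient (M0.swapSetoid n)

end

/-! A special Lagrangian plane is the fixed set of an antilinear involution `v ↦ S v̄` with `S`
unitary, symmetric and of determinant one. This identifies `SLG n` with `SymUnitary (Fin n)`
(`symUnitaryHomeomorphSLG`), and two planes are transverse exactly when `S - T` is invertible
(`fixedPlane_inf_eq_bot_iff`).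

For a transverse pair the unitary matrix `-T S*` does not have the eigenvalue `-1`, hence it has a
continuous hermitian logarithm `relArg`, of norm less than `π`. For `n = 3` its determinant is `-1`,
so the trace of `relArg` is an odd multiple of `π` of absolute value less than `3π`, that is `π` or
`-π` (`trace_relArg`). The sign splits the space into two clopen pieces. For fixed `S` and fixed
sign, the admissible logarithms form a convex set (`convex_relDomain`) containing a scalar matrix,
so each piece deformation retracts onto a copy of `SymUnitary (Fin 3)`
(`isSimplyConnected_pairSign_preimage`).

It remains to see that `SymUnitary (Fin 3)` is simply connected (`simplyConnectedSpace_symUnitary`).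
It is covered by three open sets, each homeomorphic through the exponential to a convex set of real
symmetric logarithms of trace `2πk`, with `k` taken modulo 3. The three sets have a common point and
path connected pairwise intersections, so the easy half of van Kampen's theorem applies.

Interchanging the planes negates `relArg` and hence exchanges the two pieces, so the quotient by the
involution is homeomorphic to one piece. -/

open scoped Matrix.Norms.L2Operator

/-! ### The exponential `A ↦ exp (iA)` on hermitian matrices and its inverse. -/

section HermitianExponential

open Matrix Complex

variable {n : Type*} [Fintype n] [DecidableEq n]

/-- The unitary matrix `exp (iA)`. -/
noncomputable def expI (A : Matrix n n ℂ) : Matrix n n ℂ := NormedSpace.exp (I • A)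

/-- The principal argument of a unitary matrix, a hermitian matrix. -/
noncomputable def argU (W : Matrix n n ℂ) : Matrix n n ℂ := cfc (fun z : ℂ => (arg z : ℂ)) W

/-- The diagonal matrix with the given real entries, as a complex matrix. -/
noncomputable def rdiag (a : n → ℝ) : Matrix n n ℂ := diagonal fun i => (a i : ℂ)

theorem continuous_expI : Continuous (expI : Matrix n n ℂ → Matrix n n ℂ) := by
  unfold expI
  let _ : NormedAlgebra ℚ (Matrix n n ℂ) := NormedAlgebra.restrictScalars ℚ ℂ _
  have : Continuous (NormedSpace.exp : Matrix n n ℂ → Matrix n n ℂ) :=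
    NormedSpace.exp_continuous
  exact this.comp (continuous_const_smul I)

theorem expI_mem_unitary {A : Matrix n n ℂ} (hA : A.IsHermitian) :
    expI A ∈ unitary (Matrix n n ℂ) :=
  (selfAdjoint.expUnitary ⟨A, hA⟩).2

theorem argU_expI {A : Matrix n n ℂ} (hA : A.IsHermitian) (h : ‖A‖ < Real.pi) :
    argU (expI A) = A := by
  have := argSelfAdjoint_expUnitary (x := (⟨A, hA⟩ : selfAdjoint (Matrix n n ℂ))) h
  exact congrArg Subtype.val this

theorem expI_inj {A B : Matrix n n ℂ} (hA : A.IsHermitian) (hB : B.IsHermitian)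
    (h : ‖A‖ < Real.pi) (h' : ‖B‖ < Real.pi) (e : expI A = expI B) : A = B := by
  rw [← argU_expI hA h, e, argU_expI hB h']

theorem expI_argU {W : Matrix n n ℂ} (hW : W ∈ unitary (Matrix n n ℂ)) (h : ‖W - 1‖ < 2) :
    expI (argU W) = W := by
  have := expUnitary_argSelfAdjoint (u := (⟨W, hW⟩ : unitary (Matrix n n ℂ))) h
  exact congrArg Subtype.val this

theorem argU_isHermitian (W : Matrix n n ℂ) : (argU W).IsHermitian := IsSelfAdjoint.cfc_arg W

theorem norm_argU_lt {W : Matrix n n ℂ} (hW : W ∈ unitary (Matrix n n ℂ)) (h : ‖W - 1‖ < 2) :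
    ‖argU W‖ < Real.pi := by
  have := (Unitary.openPartialHomeomorph (A := Matrix n n ℂ)).map_source'
    (x := ⟨W, hW⟩) (by simpa [Subtype.dist_eq, dist_eq_norm] using h)
  simpa [argU] using this

theorem norm_expI_sub_one_lt {A : Matrix n n ℂ} (hA : A.IsHermitian) (h : ‖A‖ < Real.pi) :
    ‖expI A - 1‖ < 2 := by
  have := (Unitary.openPartialHomeomorph (A := Matrix n n ℂ)).map_target'
    (x := ⟨A, hA⟩) (by simpa using h)
  simpa [Subtype.dist_eq, dist_eq_norm, expI] using this

theorem continuousOn_argU : ContinuousOn (argU : Matrix n n ℂ → Matrix n n ℂ)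
    {W | W ∈ unitary (Matrix n n ℂ) ∧ ‖W - 1‖ < 2} := by
  have h1 := Unitary.continuousOn_argSelfAdjoint (A := Matrix n n ℂ)
  have h2 : ContinuousOn (fun u : unitary (Matrix n n ℂ) => argU (u : Matrix n n ℂ))
      (Metric.ball 1 2) := continuous_subtype_val.comp_continuousOn h1
  rw [continuousOn_iff_continuous_domRestrict] at h2 ⊢
  have h3 : Continuous (fun W : {W : Matrix n n ℂ | W ∈ unitary (Matrix n n ℂ) ∧ ‖W - 1‖ < 2} =>
      (⟨⟨W.1, W.2.1⟩, by simpa [Subtype.dist_eq, dist_eq_norm] using W.2.2⟩ :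
        Metric.ball (1 : unitary (Matrix n n ℂ)) 2)) := by
    fun_prop
  exact h2.comp h3

/-- Distance 2 from the identity is reached exactly when `-1` is an eigenvalue. This lets
transversality of planes place a matrix in the domain where `argU` inverts `expI`. -/
theorem norm_sub_one_lt_two_iff_det {W : Matrix n n ℂ} (hW : W ∈ unitary (Matrix n n ℂ)) :
    ‖W - 1‖ < 2 ↔ (W + 1).det ≠ 0 := by
  rw [Unitary.norm_sub_one_lt_two_iff hW, spectrum.notMem_iff, Matrix.isUnit_iff_isUnit_det,
    isUnit_iff_ne_zero]
  have : algebraMap ℂ (Matrix n n ℂ) (-1) - W = -(W + 1) := by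
    simp [sub_eq_add_neg, add_comm]
  rw [this, Matrix.det_neg]
  simp

theorem norm_unitary_conj {U : Matrix n n ℂ} (hU : U ∈ unitary (Matrix n n ℂ))
    (A : Matrix n n ℂ) : ‖U * A * star U‖ = ‖A‖ := by
  rw [CStarRing.norm_mul_mem_unitary _ (Unitary.star_mem hU), CStarRing.norm_mem_unitary_mul _ hU]

theorem expI_conj {U : Matrix n n ℂ} (hU : U ∈ unitary (Matrix n n ℂ)) (A : Matrix n n ℂ) :
    expI (U * A * star U) = U * expI A * star U := by
  have := Matrix.exp_units_conj (𝔸 := ℂ)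
    ⟨U, star U, Unitary.mul_star_self_of_mem hU, Unitary.star_mul_self_of_mem hU⟩ (I • A)
  simpa [expI] using this

theorem expI_rdiag (a : n → ℝ) : expI (rdiag a) = diagonal fun i => Complex.exp (a i * I) := by
  have : I • rdiag a = diagonal fun i => (a i * I : ℂ) := by
    ext i j
    by_cases h : i = j <;> simp [rdiag, h, mul_comm]
  rw [expI, this, Matrix.exp_diagonal]
  congr 1
  ext i
  simp [Complex.exp_eq_exp_ℂ]

theorem expI_conj_rdiag {U : Matrix n n ℂ} (hU : U ∈ unitary (Matrix n n ℂ)) (a : n → ℝ) :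
    expI (U * rdiag a * star U) = U * (diagonal fun i => Complex.exp (a i * I)) * star U := by
  rw [expI_conj hU, expI_rdiag]

theorem expI_transpose (A : Matrix n n ℂ) : expI Aᵀ = (expI A)ᵀ := by
  rw [expI, expI, ← Matrix.exp_transpose, Matrix.transpose_smul]

theorem expI_neg (A : Matrix n n ℂ) : expI (-A) = star (expI Aᴴ) := by
  rw [expI, expI, star_eq_conjTranspose, ← Matrix.exp_conjTranspose]
  simp

theorem expI_add_real (A : Matrix n n ℂ) (c : ℝ) :
    expI (A + (c : ℂ) • 1) = Complex.exp (c * I) • expI A := by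
  have h1 : expI ((c : ℂ) • (1 : Matrix n n ℂ)) = Complex.exp (c * I) • 1 := by
    have := expI_rdiag (n := n) fun _ => c
    rw [show rdiag (fun _ : n => c) = (c : ℂ) • 1 by
      ext i j; by_cases h : i = j <;> simp [rdiag, h]] at this
    rw [this]
    ext i j; by_cases h : i = j <;> simp [h]
  have h2 : expI (A + (c : ℂ) • 1) = expI A * expI ((c : ℂ) • 1) := by
    rw [expI, smul_add, Matrix.exp_add_of_commute]
    · rfl
    · exact ((Commute.one_right A).smul_right _).smul_left _ |>.smul_right _
  rw [h2, h1]; simp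

theorem Matrix.IsHermitian.exists_eq_conj_rdiag {A : Matrix n n ℂ} (hA : A.IsHermitian) :
    ∃ U ∈ unitary (Matrix n n ℂ), ∃ a : n → ℝ, A = U * rdiag a * star U := by
  refine ⟨hA.eigenvectorUnitary, hA.eigenvectorUnitary.2, hA.eigenvalues, ?_⟩
  conv_lhs => rw [hA.spectral_theorem]
  simp [rdiag, Unitary.conjStarAlgAut_apply, Function.comp_def]

omit [Fintype n] in
theorem rdiag_isHermitian (a : n → ℝ) : (rdiag a).IsHermitian := by
  ext i j
  by_cases h : i = j
  · simp [rdiag, h]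
  · simp [rdiag, h, Ne.symm h]

theorem conj_rdiag_isHermitian (U : Matrix n n ℂ) (a : n → ℝ) :
    (U * rdiag a * star U).IsHermitian := by
  rw [star_eq_conjTranspose]
  exact isHermitian_mul_mul_conjTranspose U (rdiag_isHermitian a)

theorem trace_conj_rdiag {U : Matrix n n ℂ} (hU : U ∈ unitary (Matrix n n ℂ)) (a : n → ℝ) :
    (U * rdiag a * star U).trace = ((∑ i, a i : ℝ) : ℂ) := by
  rw [Matrix.trace_mul_comm, ← mul_assoc, Unitary.star_mul_self_of_mem hU, one_mul]
  simp [rdiag, Matrix.trace]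

theorem norm_rdiag_lt_iff [Nonempty n] {a : n → ℝ} {r : ℝ} : ‖rdiag a‖ < r ↔ ∀ i, |a i| < r := by
  rw [rdiag, Matrix.l2_opNorm_diagonal]
  have h0 := ‹Nonempty n›
  constructor
  · intro h i
    have := norm_le_pi_norm (fun i => (a i : ℂ)) i
    simp only [Complex.norm_real, Real.norm_eq_abs] at this
    linarith
  · intro h
    have hr : 0 < r := (abs_nonneg _).trans_lt (h h0.some)
    rw [pi_norm_lt_iff hr]
    simpa using h

theorem conj_rdiag_sub_smul {U : Matrix n n ℂ} (hU : U ∈ unitary (Matrix n n ℂ)) (a : n → ℝ)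
    (c : ℝ) : U * rdiag a * star U - (c : ℂ) • 1 = U * rdiag (fun i => a i - c) * star U := by
  have : rdiag (fun i => a i - c) = rdiag a - (c : ℂ) • 1 := by
    ext i j; by_cases h : i = j <;> simp [rdiag, h]
  rw [this, mul_sub, sub_mul, mul_smul_comm, mul_one, smul_mul_assoc,
    Unitary.mul_star_self_of_mem hU]

theorem det_expI {A : Matrix n n ℂ} (hA : A.IsHermitian) :
    (expI A).det = Complex.exp (A.trace * I) := by
  obtain ⟨U, hU, a, rfl⟩ := hA.exists_eq_conj_rdiag
  rw [expI_conj_rdiag hU, trace_conj_rdiag hU, Matrix.det_mul_right_comm,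
    Unitary.mul_star_self_of_mem hU, one_mul, Matrix.det_diagonal, ← Complex.exp_sum]
  simp [Finset.sum_mul]

theorem Matrix.IsHermitian.trace_eq_re {A : Matrix n n ℂ} (hA : A.IsHermitian) :
    A.trace = (A.trace.re : ℂ) := by
  obtain ⟨U, hU, a, rfl⟩ := hA.exists_eq_conj_rdiag
  rw [trace_conj_rdiag hU, Complex.ofReal_re]

theorem abs_trace_re_lt [Nonempty n] {A : Matrix n n ℂ} (hA : A.IsHermitian) {r : ℝ}
    (h : ‖A‖ < r) : |A.trace.re| < Fintype.card n * r := by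
  obtain ⟨U, hU, a, rfl⟩ := hA.exists_eq_conj_rdiag
  rw [norm_unitary_conj hU, norm_rdiag_lt_iff] at h
  rw [trace_conj_rdiag hU, Complex.ofReal_re]
  calc |∑ i, a i| ≤ ∑ i, |a i| := Finset.abs_sum_le_sum_abs _ _
    _ < ∑ _i : n, r := Finset.sum_lt_sum_of_nonempty Finset.univ_nonempty fun i _ => h i
    _ = _ := by simp

theorem transpose_mem_unitary {U : Matrix n n ℂ} (hU : U ∈ unitary (Matrix n n ℂ)) :
    Uᵀ ∈ unitary (Matrix n n ℂ) := by
  rw [Unitary.mem_iff] at hU ⊢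
  simp only [star_eq_conjTranspose] at hU ⊢
  constructor
  · rw [← Matrix.transpose_one, ← hU.2, Matrix.transpose_mul]; rfl
  · rw [← Matrix.transpose_one, ← hU.1, Matrix.transpose_mul]; rfl

theorem norm_transpose_of_isHermitian {A : Matrix n n ℂ} (hA : A.IsHermitian) : ‖Aᵀ‖ = ‖A‖ := by
  obtain ⟨U, hU, a, rfl⟩ := hA.exists_eq_conj_rdiag
  have hd : (rdiag a)ᵀ = rdiag a := by simp [rdiag]
  have h2 : (star U)ᵀ ∈ unitary (Matrix n n ℂ) := transpose_mem_unitary (Unitary.star_mem hU)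
  have h3 : Uᵀ = star ((star U)ᵀ) := by
    ext i j
    simp [star_eq_conjTranspose]
  rw [norm_unitary_conj hU, Matrix.transpose_mul, Matrix.transpose_mul, hd, h3, ← mul_assoc,
    norm_unitary_conj h2]

/-- On this domain `argU` is the inverse of `expI`, so it inherits every symmetry of `expI` that
preserves the norm bound. The same argument gives `argU_conj` and `argU_star`. -/
theorem argU_transpose {W : Matrix n n ℂ} (hW : W ∈ unitary (Matrix n n ℂ)) (h : ‖W - 1‖ < 2) :
    argU Wᵀ = (argU W)ᵀ := by
  have hA := argU_isHermitian W
  conv_lhs => rw [← expI_argU hW h]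
  rw [← expI_transpose, argU_expI hA.transpose]
  rw [norm_transpose_of_isHermitian hA]
  exact norm_argU_lt hW h

theorem argU_conj {U W : Matrix n n ℂ} (hU : U ∈ unitary (Matrix n n ℂ))
    (hW : W ∈ unitary (Matrix n n ℂ)) (h : ‖W - 1‖ < 2) :
    argU (U * W * star U) = U * argU W * star U := by
  have hA := argU_isHermitian W
  conv_lhs => rw [← expI_argU hW h]
  rw [← expI_conj hU, argU_expI]
  · rw [star_eq_conjTranspose]
    exact isHermitian_mul_mul_conjTranspose U hA
  · rw [norm_unitary_conj hU]
    exact norm_argU_lt hW h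

theorem argU_star {W : Matrix n n ℂ} (hW : W ∈ unitary (Matrix n n ℂ)) (h : ‖W - 1‖ < 2) :
    argU (star W) = -argU W := by
  have hA := argU_isHermitian W
  conv_lhs => rw [← expI_argU hW h]
  have : star (expI (argU W)) = expI (-argU W) := by rw [expI_neg, hA.eq]
  rw [this, argU_expI hA.neg]
  rw [norm_neg]
  exact norm_argU_lt hW h

/-- A symmetric hermitian matrix, that is a real symmetric one, is diagonalized by a real
orthogonal matrix. -/
theorem Matrix.IsHermitian.exists_eq_real_conj_rdiag {A : Matrix n n ℂ} (hA : A.IsHermitian)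
    (hs : Aᵀ = A) : ∃ U ∈ unitary (Matrix n n ℂ), star U = Uᵀ ∧ ∃ a : n → ℝ,
      A = U * rdiag a * star U := by
  have hreal : A = (A.map Complex.re).map Complex.ofReal := by
    ext i j
    have h1 := hA.apply i j
    have h2 : A j i = A i j := congrFun (congrFun hs i) j
    rw [h2] at h1
    simpa using (Complex.conj_eq_iff_re.mp h1).symm
  have hB : (A.map Complex.re).IsHermitian := by
    ext i j
    have h2 : A j i = A i j := congrFun (congrFun hs i) j
    simp [h2]
  set B := A.map Complex.re
  set V : Matrix n n ℝ := hB.eigenvectorUnitary.1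
  have hV : V ∈ unitary (Matrix n n ℝ) := hB.eigenvectorUnitary.2
  have hst : star (V.map Complex.ofReal) = (V.map Complex.ofReal)ᵀ := by
    ext i j; simp
  have hst' : (star V).map Complex.ofReal = star (V.map Complex.ofReal) := by
    ext i j; simp
  have hmul (P Q : Matrix n n ℝ) : (P * Q).map Complex.ofReal =
      P.map Complex.ofReal * Q.map Complex.ofReal :=
    Matrix.map_mul (f := Complex.ofRealHom)
  have hone : (1 : Matrix n n ℝ).map Complex.ofReal = 1 :=
    Matrix.map_one _ Complex.ofReal_zero Complex.ofReal_one
  refine ⟨V.map Complex.ofReal, ?_, hst, hB.eigenvalues, ?_⟩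
  · rw [Unitary.mem_iff, ← hst', ← hmul, ← hmul, hV.1, hV.2, hone]
    simp
  · have h := hB.spectral_theorem
    rw [Unitary.conjStarAlgAut_apply] at h
    conv_lhs => rw [hreal, h]
    rw [hmul, hmul, hst']
    congr 2
    ext i j; by_cases h : i = j <;> simp [h, rdiag]

end HermitianExponential

/-! ### Simple connectedness from an open cover. -/

section VanKampen

open unitInterval

variable {X : Type*} [TopologicalSpace X]

theorem IsSimplyConnected.homotopic {U : Set X} (hU : IsSimplyConnected U) {x y : X}
    (p q : Path x y) (hp : ∀ t, p t ∈ U) (hq : ∀ t, q t ∈ U) : p.Homotopic q := by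
  have := hU.simplyConnectedSpace
  have hx : x ∈ U := by simpa using hp 0
  have hy : y ∈ U := by simpa using hp 1
  let lift (r : Path x y) (hr : ∀ t, r t ∈ U) : Path (⟨x, hx⟩ : U) ⟨y, hy⟩ :=
    { toFun := fun t => ⟨r t, hr t⟩
      source' := by simp
      target' := by simp }
  exact (SimplyConnectedSpace.paths_homotopic (lift p hp) (lift q hq)).map
    ⟨Subtype.val, continuous_subtype_val⟩

/-- The easy half of the van Kampen theorem: a space covered by simply connected open sets with a
common point and with path connected pairwise intersections is simply connected. -/
theorem simplyConnectedSpace_of_open_cover {ι : Type*} (U : ι → Set X) (hU : ∀ i, IsOpen (U i))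
    (hcover : ∀ x, ∃ i, x ∈ U i) (x₀ : X) (hx₀ : ∀ i, x₀ ∈ U i)
    (hsc : ∀ i, IsSimplyConnected (U i)) (hpc : ∀ i j, IsPathConnected (U i ∩ U j)) :
    SimplyConnectedSpace X := by
  -- A good path is homotopic to every path with the same endpoints that stays in a single member of
  -- the cover. Every path starting at a common point turns out to be good, by subdivision.
  let Good {a y : X} (p : Path a y) : Prop :=
    ∀ i, ∀ q : Path a y, (∀ t, q t ∈ U i) → p.Homotopic q
  have good_refl (a : X) : Good (Path.refl a) := fun i q hq =>
    (hsc i).homotopic _ _ (fun t => by simpa using hq 0) hq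
  have good_congr {a y : X} {p p' : Path a y} (h : p.Homotopic p') (hp : Good p) : Good p' :=
    fun i q hq => h.symm.trans (hp i q hq)
  have good_trans {a y z : X} (ha : ∀ i, a ∈ U i) (p : Path a y) (hp : Good p) (s : Path y z)
      (j : ι) (hs : ∀ t, s t ∈ U j) : Good (p.trans s) := by
    intro i q hq
    have hy : y ∈ U j := by simpa using hs 0
    have hz : z ∈ U j := by simpa using hs 1
    have hz' : z ∈ U i := by simpa using hq 1
    -- Since `p` is good, it may be replaced by `p'` inside `U j`. Then `p'` followed by `s` lies in
    -- `U j` and is homotopic there to `r`, which runs in `U i ∩ U j` and is homotopic to `q` inside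
    -- `U i`.
    obtain ⟨r, hr⟩ := (hpc i j).joinedIn a ⟨ha i, ha j⟩ z ⟨hz', hz⟩
    obtain ⟨p', hp'⟩ := (hsc j).isPathConnected.joinedIn a (ha j) y hy
    have h1 : (p.trans s).Homotopic (p'.trans s) := (hp j p' hp').hcomp (.refl s)
    have h2 : (p'.trans s).Homotopic r := by
      refine (hsc j).homotopic _ _ (fun t => ?_) fun t => (hr t).2
      have : (p'.trans s) t ∈ Set.range (p'.trans s) := ⟨t, rfl⟩
      rw [Path.trans_range] at this
      rcases this with ⟨t, ht⟩ | ⟨t, ht⟩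
      · rw [← ht]; exact hp' t
      · rw [← ht]; exact hs t
    have h3 : r.Homotopic q := (hsc i).homotopic _ _ (fun t => (hr t).1) hq
    exact (h1.trans h2).trans h3
  have good_all {a y : X} (ha : ∀ i, a ∈ U i) (γ : Path a y) : Good γ := by
    obtain ⟨t, ht0, htm, ⟨N, hN⟩, ht⟩ := exists_monotone_Icc_subset_open_cover_unitInterval
      (c := fun i => γ ⁻¹' U i) (fun i => (hU i).preimage γ.continuous)
      (fun s _ => by
        obtain ⟨i, hi⟩ := hcover (γ s)
        exact Set.mem_iUnion.mpr ⟨i, hi⟩)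
    have key (k : ℕ) : Good (γ.subpath 0 (t k)) := by
      induction k with
      | zero =>
        rw [ht0, Path.subpath_self]
        exact good_refl _
      | succ k ih =>
        obtain ⟨j, hj⟩ := ht k
        refine good_congr ⟨Path.Homotopy.subpathTransSubpath γ 0 (t k) (t (k + 1))⟩
          (good_trans (by simpa using ha) _ ih _ j fun s => ?_)
        have : γ.subpath (t k) (t (k + 1)) s ∈ Set.range (γ.subpath (t k) (t (k + 1))) := ⟨s, rfl⟩
        rw [Path.range_subpath_of_le _ _ _ (htm (Nat.le_succ k))] at this
        obtain ⟨s', hs', h⟩ := this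
        rw [← h]
        exact hj hs'
    have h1 := key N
    rw [hN N le_rfl, Path.subpath_zero_one] at h1
    intro i q hq
    exact (h1 i (q.cast γ.source γ.target) hq).pathCast γ.source.symm γ.target.symm
  rw [simply_connected_iff_paths_homotopic']
  have hjoin (x : X) : Joined x₀ x := by
    obtain ⟨i, hi⟩ := hcover x
    exact ((hsc i).isPathConnected.joinedIn x₀ (hx₀ i) x hi).joined
  refine ⟨⟨⟨x₀⟩, fun x y => (hjoin x).symm.trans (hjoin y)⟩, fun {x y} p q => ?_⟩
  obtain ⟨r⟩ := hjoin x
  obtain ⟨i, hi⟩ := hcover y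
  obtain ⟨s, hs⟩ := (hsc i).isPathConnected.joinedIn x₀ (hx₀ i) y hi
  -- Both paths start at `x₀` and are good, so both are homotopic to the same short path `s`.
  -- Cancelling `r` then gives the homotopy of `p` and `q`.
  have h : (r.trans p).Homotopic (r.trans q) :=
    (good_all hx₀ _ i s hs).trans (good_all hx₀ _ i s hs).symm
  rw [← Path.Homotopic.Quotient.eq] at h ⊢
  rw [Path.Homotopic.Quotient.mk_trans, Path.Homotopic.Quotient.mk_trans] at h
  have h' := congrArg (Path.Homotopic.Quotient.trans (.symm (.mk r))) h
  simpa [← Path.Homotopic.Quotient.trans_assoc] using h'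

end VanKampen

/-! ### Components and free involutions from a two-valued continuous map. -/

section BoolFibres

variable {X : Type*} [TopologicalSpace X]

theorem connectedComponent_eq_preimage {f : X → Bool} (hf : Continuous f)
    (hc : ∀ b, IsConnected (f ⁻¹' {b})) (x : X) : connectedComponent x = f ⁻¹' {f x} := by
  refine Set.Subset.antisymm ?_ ((hc (f x)).isPreconnected.subset_connectedComponent rfl)
  have : IsClopen (f ⁻¹' {f x}) := (isClopen_discrete {f x}).preimage hf
  exact this.connectedComponent_subset rfl

theorem card_connectedComponents_eq_two {f : X → Bool} (hf : Continuous f)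
    (hc : ∀ b, IsConnected (f ⁻¹' {b})) : Nat.card (ConnectedComponents X) = 2 := by
  have hbij : Function.Bijective (hf.connectedComponentsLift) := by
    constructor
    · intro a b h
      obtain ⟨x, rfl⟩ := ConnectedComponents.surjective_coe a
      obtain ⟨y, rfl⟩ := ConnectedComponents.surjective_coe b
      simp only [Continuous.connectedComponentsLift_apply_coe] at h
      rw [ConnectedComponents.coe_eq_coe, connectedComponent_eq_preimage hf hc,
        connectedComponent_eq_preimage hf hc, h]
    · intro b
      obtain ⟨x, hx⟩ := (hc b).nonempty
      exact ⟨x, by simpa using hx⟩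
  rw [Nat.card_congr (Equiv.ofBijective _ hbij)]
  simp

/-- If an involution exchanges the two fibres of a continuous map to `Bool`, then the quotient by
the involution is homeomorphic to a fibre. -/
noncomputable def fibreHomeomorphQuotient {f : X → Bool} (hf : Continuous f) {σ : X → X}
    (hσ : Continuous σ) (hfσ : ∀ x, f (σ x) = !f x) (s : Setoid X)
    (hs : ∀ x y, s x y ↔ x = y ∨ x = σ y) : f ⁻¹' {true} ≃ₜ Quotient s :=
  let g : f ⁻¹' {true} → Quotient s := fun x => Quotient.mk s x.1
  have hg : Continuous g := continuous_quotient_mk'.comp continuous_subtype_val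
  have hbij : Function.Bijective g := by
    constructor
    · rintro ⟨x, hx⟩ ⟨y, hy⟩ h
      have h' : s x y := Quotient.exact h
      rw [hs] at h'
      rcases h' with h' | h'
      · exact Subtype.ext h'
      · have hx' : f x = true := hx
        have hy' : f y = true := hy
        have := hfσ y
        rw [← h', hx', hy'] at this
        simp at this
    · intro q
      induction q using Quotient.inductionOn with
      | _ x =>
        cases hx : f x with
        | true => exact ⟨⟨x, hx⟩, rfl⟩
        | false =>
          refine ⟨⟨σ x, by simp [hfσ, hx]⟩, Quotient.sound ?_⟩
          exact (hs _ _).mpr (Or.inr rfl)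
  have hopen : IsOpenMap g := by
    intro V hV
    have hV' : IsOpen (Subtype.val '' V : Set X) :=
      ((isOpen_discrete {true}).preimage hf).isOpenMap_subtype_val V hV
    have : IsOpen (Quotient.mk s ⁻¹' (g '' V)) := by
      -- The saturation of a subset is its union with its preimage under the involution, which is
      -- why images of open sets are open.
      have : Quotient.mk s ⁻¹' (g '' V) = Subtype.val '' V ∪ σ ⁻¹' (Subtype.val '' V) := by
        ext x
        constructor
        · rintro ⟨v, hv, h⟩
          have h' : s v.1 x := Quotient.exact h
          rw [hs] at h'
          rcases h' with h' | h'
          · exact Or.inl ⟨v, hv, h'⟩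
          · exact Or.inr ⟨v, hv, h'⟩
        · rintro (⟨v, hv, h⟩ | ⟨v, hv, h⟩)
          · exact ⟨v, hv, Quotient.sound ((hs _ _).mpr (Or.inl h))⟩
          · exact ⟨v, hv, Quotient.sound ((hs _ _).mpr (Or.inr h))⟩
      rw [this]
      exact hV'.union (hV'.preimage hσ)
    exact this
  (Equiv.ofBijective g hbij).toHomeomorphOfContinuousOpen hg hopen

end BoolFibres

/-! ### Exponential charts on symmetric special unitary matrices. -/

section SymmetricUnitary

open Matrix Complex

variable {n : Type*} [Fintype n] [DecidableEq n]

theorem expI_sub_real (A : Matrix n n ℂ) (c : ℝ) :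
    expI (A - (c : ℂ) • 1) = Complex.exp (-(c * I)) • expI A := by
  have := expI_add_real A (-c)
  simpa [sub_eq_add_neg] using this

omit [Fintype n] in
theorem real_smul_one_isHermitian (c : ℝ) : ((c : ℂ) • (1 : Matrix n n ℂ)).IsHermitian := by
  simp [Matrix.IsHermitian]

theorem real_smul_one_trace (c : ℝ) :
    ((c : ℂ) • (1 : Matrix n n ℂ)).trace = Fintype.card n * c := by
  simp [mul_comm]

/-- Two logarithms of a symmetric unitary matrix, each with spectrum in an interval of length
`2π`, are simultaneously diagonalized by a real orthogonal matrix, and their eigenvalues differ by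
multiples of `2π`. -/
theorem exists_common_diagonalization [Nonempty n] {A A' : Matrix n n ℂ} (hA : A.IsHermitian)
    (hs : Aᵀ = A) (hA' : A'.IsHermitian) {c c' : ℝ} (h : ‖A - (c : ℂ) • 1‖ < Real.pi)
    (h' : ‖A' - (c' : ℂ) • 1‖ < Real.pi) (he : expI A = expI A') :
    ∃ U ∈ unitary (Matrix n n ℂ), star U = Uᵀ ∧ ∃ (a : n → ℝ) (m : n → ℤ),
      A = U * rdiag a * star U ∧ A' = U * rdiag (fun i => a i + 2 * Real.pi * m i) * star U ∧
      (∀ i, |a i - c| < Real.pi) ∧ ∀ i, |a i + 2 * Real.pi * m i - c'| < Real.pi := by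
  obtain ⟨U, hU, hUs, a, rfl⟩ := hA.exists_eq_real_conj_rdiag hs
  have hm (i : n) : ∃ m : ℤ, a i + 2 * Real.pi * m ∈ Set.Ioc (c' - Real.pi) (c' + Real.pi) := by
    obtain ⟨m, hm, -⟩ := existsUnique_add_zsmul_mem_Ioc Real.two_pi_pos (a i) (c' - Real.pi)
    refine ⟨m, ?_⟩
    have : c' - Real.pi + 2 * Real.pi = c' + Real.pi := by ring
    rw [this] at hm
    simpa [mul_comm] using hm
  choose m hm using hm
  -- At the endpoint `c' + π` the matrix `expI (A' - c')` would have the eigenvalue `-1`, at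
  -- distance 2 from 1, contradicting the spectral bound on `A'`.
  have hne (i : n) : a i + 2 * Real.pi * m i ≠ c' + Real.pi := by
    intro hi
    have h1 := norm_expI_sub_one_lt (hA'.sub (real_smul_one_isHermitian c')) h'
    have h2 : expI (A' - (c' : ℂ) • 1) =
        U * (diagonal fun i => Complex.exp ((a i - c' : ℝ) * I)) * star U := by
      rw [expI_sub_real, ← he, ← expI_sub_real, conj_rdiag_sub_smul hU, expI_conj_rdiag hU]
    have h3 : U * (diagonal fun i => Complex.exp ((a i - c' : ℝ) * I)) * star U - 1 =
        U * (diagonal fun i => Complex.exp ((a i - c' : ℝ) * I) - 1) * star U := by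
      have : (diagonal fun i => Complex.exp ((a i - c' : ℝ) * I) - 1) =
          (diagonal fun i => Complex.exp ((a i - c' : ℝ) * I)) - (1 : Matrix n n ℂ) := by
        rw [← diagonal_one, diagonal_sub]
      rw [this, mul_sub, sub_mul, mul_one, Unitary.mul_star_self_of_mem hU]
    rw [h2, h3, norm_unitary_conj hU, l2_opNorm_diagonal, pi_norm_lt_iff two_pos] at h1
    have h4 := h1 i
    have h5 : Complex.exp ((a i - c' : ℝ) * I) = -1 := by
      have : ((a i - c' : ℝ) * I : ℂ) = Real.pi * I - (m i : ℤ) * (2 * Real.pi * I) := by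
        have : a i - c' = Real.pi - m i * (2 * Real.pi) := by linarith
        rw [this]; push_cast; ring
      rw [this, Complex.exp_sub, Complex.exp_int_mul_two_pi_mul_I, Complex.exp_pi_mul_I, div_one]
    rw [h5] at h4
    norm_num at h4
  have hlt (i : n) : |a i + 2 * Real.pi * m i - c'| < Real.pi := by
    have := lt_of_le_of_ne (hm i).2 (hne i)
    rw [abs_lt]
    constructor <;> linarith [(hm i).1]
  refine ⟨U, hU, hUs, a, m, rfl, ?_, ?_, hlt⟩
  · have h1 : A' - (c' : ℂ) • 1 =
        U * rdiag (fun i => a i + 2 * Real.pi * m i) * star U - (c' : ℂ) • 1 := by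
      refine expI_inj (hA'.sub (real_smul_one_isHermitian c'))
        ((conj_rdiag_isHermitian U _).sub (real_smul_one_isHermitian c')) h' ?_ ?_
      · rw [conj_rdiag_sub_smul hU, norm_unitary_conj hU, norm_rdiag_lt_iff]
        exact hlt
      · rw [expI_sub_real, expI_sub_real, ← he, expI_conj_rdiag hU, expI_conj_rdiag hU]
        congr 5
        ext i
        have : ((a i + 2 * Real.pi * m i : ℝ) * I : ℂ) =
            a i * I + (m i : ℤ) * (2 * Real.pi * I) := by push_cast; ring
        rw [this, Complex.exp_add, Complex.exp_int_mul_two_pi_mul_I, mul_one]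
    exact (sub_left_injective h1)
  · rw [conj_rdiag_sub_smul hU, norm_unitary_conj hU, norm_rdiag_lt_iff] at h
    exact h

/-- Both `x - y` and `x - y + 2π (p - q)` have absolute value less than `2π`, so `2π (p - q) < 4π`.
-/
theorem int_abs_sub_lt_two {x y c c' : ℝ} {p q : ℤ} (hx : |x - c| < Real.pi)
    (hy : |y - c| < Real.pi) (hx' : |x + 2 * Real.pi * p - c'| < Real.pi)
    (hy' : |y + 2 * Real.pi * q - c'| < Real.pi) : p - q < 2 := by
  rw [abs_lt] at hx hy hx' hy'
  have h : Real.pi * (p - q : ℝ) < Real.pi * 2 := by linarith [hx.1, hx.2, hy.1, hy.2]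
  have := lt_of_mul_lt_mul_left h Real.pi_pos.le
  exact_mod_cast this

variable (n) in
/-- The symmetric special unitary matrices. -/
def SymUnitary : Set (Matrix n n ℂ) := {S | S ∈ unitary (Matrix n n ℂ) ∧ Sᵀ = S ∧ S.det = 1}

variable (n) in
/-- The real symmetric matrices of trace `2πk` with spectrum in an open interval of length `2π`. -/
def logDomain (k : ℤ) : Set (Matrix n n ℂ) :=
  {A | A.IsHermitian ∧ Aᵀ = A ∧ A.trace = 2 * Real.pi * k ∧
    ∃ c : ℝ, ‖A - (c : ℂ) • 1‖ < Real.pi}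

theorem expI_mem_symUnitary {k : ℤ} {A : Matrix n n ℂ} (hA : A ∈ logDomain n k) :
    expI A ∈ SymUnitary n := by
  obtain ⟨h1, h2, h3, -⟩ := hA
  refine ⟨expI_mem_unitary h1, by rw [← expI_transpose, h2], ?_⟩
  rw [det_expI h1, h3]
  have : (2 * Real.pi * k * I : ℂ) = k * (2 * Real.pi * I) := by ring
  rw [this, Complex.exp_int_mul_two_pi_mul_I]

/-- The centre `c` is allowed to depend on the matrix: the same convex combination of the centres
serves for the combined matrix. -/
theorem convex_logDomain (k : ℤ) : Convex ℝ (logDomain n k) := by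
  rintro A ⟨hA, hs, ht, c, hc⟩ B ⟨hB, hs', ht', c', hc'⟩ x y hx hy hxy
  refine ⟨?_, ?_, ?_, x * c + y * c', ?_⟩
  · exact (hA.smul (IsSelfAdjoint.all x)).add (hB.smul (IsSelfAdjoint.all y))
  · rw [transpose_add, transpose_smul, transpose_smul, hs, hs']
  · rw [trace_add, trace_smul, trace_smul, ht, ht', ← add_smul, hxy, one_smul]
  · have : x • A + y • B - ((x * c + y * c' : ℝ) : ℂ) • (1 : Matrix n n ℂ) =
        x • (A - (c : ℂ) • 1) + y • (B - (c' : ℂ) • 1) := by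
      ext i j
      simp only [Matrix.add_apply, Matrix.sub_apply, Matrix.smul_apply, Complex.real_smul, smul_eq_mul]
      push_cast; ring
    rw [this]
    have := (convex_ball (0 : Matrix n n ℂ) Real.pi) (mem_ball_zero_iff.mpr hc)
      (mem_ball_zero_iff.mpr hc') hx hy hxy
    exact mem_ball_zero_iff.mp this

theorem logDomain_nonempty [Nonempty n] (k : ℤ) : (logDomain n k).Nonempty := by
  have h0 : (Fintype.card n : ℝ) ≠ 0 := by simp
  refine ⟨((2 * Real.pi * k / Fintype.card n : ℝ) : ℂ) • 1, real_smul_one_isHermitian _, by simp,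
    ?_, 2 * Real.pi * k / Fintype.card n, ?_⟩
  · rw [real_smul_one_trace]
    rw [← Complex.ofReal_natCast, ← Complex.ofReal_mul, mul_div_cancel₀ _ h0]
    push_cast; ring
  · simpa using Real.pi_pos

/-- The exponential as a map from `logDomain n k` to the symmetric special unitary matrices. -/
noncomputable def symExp (k : ℤ) (A : logDomain n k) : SymUnitary n :=
  ⟨expI A.1, expI_mem_symUnitary A.2⟩

theorem continuous_symExp (k : ℤ) : Continuous (symExp (n := n) k) :=
  (continuous_expI.comp continuous_subtype_val).subtype_mk _

/-- The eigenvalues of two logarithms differ by `2π m i`. Equal traces give `∑ m i = 0`, and the `m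
i` differ pairwise by at most one, so all of them vanish. -/
theorem symExp_injective (k : ℤ) : Function.Injective (symExp (n := Fin 3) k) := by
  rintro ⟨A, hA, hs, ht, c, hc⟩ ⟨B, hB, hs', ht', c', hc'⟩ h
  have he : expI A = expI B := congrArg Subtype.val h
  obtain ⟨U, hU, -, a, m, rfl, rfl, h1, h2⟩ := exists_common_diagonalization hA hs hB hc hc' he
  rw [trace_conj_rdiag hU] at ht ht'
  have hsum : ∑ i, m i = 0 := by
    have h3 : ∑ i, a i = ∑ i, (a i + 2 * Real.pi * m i) := by
      have := ht.trans ht'.symm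
      exact_mod_cast this
    rw [Finset.sum_add_distrib, ← Finset.mul_sum] at h3
    have h4 : 2 * Real.pi * ∑ i, (m i : ℝ) = 0 := by linarith
    have h5 := (mul_eq_zero.mp h4).resolve_left Real.two_pi_pos.ne'
    exact_mod_cast h5
  have hd (i j : Fin 3) : m i - m j < 2 := int_abs_sub_lt_two (h1 i) (h1 j) (h2 i) (h2 j)
  have hm : ∀ i, m i = 0 := by
    rw [Fin.sum_univ_three] at hsum
    have := hd 0 1; have := hd 1 0; have := hd 0 2; have := hd 2 0; have := hd 1 2; have := hd 2 1
    intro i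
    fin_cases i <;> simp only [Fin.zero_eta, Fin.mk_one, Fin.reduceFinMk] <;> omega
  simp [hm]

/-- A logarithm of a symmetric unitary matrix with spectrum in an interval centred at `c`. -/
noncomputable def logAt (c : ℝ) (S : Matrix n n ℂ) : Matrix n n ℂ :=
  argU (Complex.exp (-(c * I)) • S) + (c : ℂ) • 1

theorem exp_smul_mem_unitary {S : Matrix n n ℂ} (hS : S ∈ unitary (Matrix n n ℂ)) (c : ℝ) :
    Complex.exp (-(c * I)) • S ∈ unitary (Matrix n n ℂ) := by
  have h : star (Complex.exp (-(c * I))) * Complex.exp (-(c * I)) = 1 := by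
    rw [Complex.star_def, ← Complex.exp_conj, ← Complex.exp_add]
    simp
  rw [Unitary.mem_iff] at hS ⊢
  rw [star_smul, smul_mul_smul_comm, smul_mul_smul_comm, hS.1, hS.2, h, mul_comm, h]
  simp

theorem logAt_expI {A : Matrix n n ℂ} (hA : A.IsHermitian) {c : ℝ}
    (h : ‖A - (c : ℂ) • 1‖ < Real.pi) : logAt c (expI A) = A := by
  rw [logAt, ← expI_sub_real, argU_expI (hA.sub (real_smul_one_isHermitian c)) h, sub_add_cancel]

theorem expI_logAt {S : Matrix n n ℂ} (hS : S ∈ unitary (Matrix n n ℂ)) {c : ℝ}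
    (h : ‖Complex.exp (-(c * I)) • S - 1‖ < 2) : expI (logAt c S) = S := by
  rw [logAt, expI_add_real, expI_argU (exp_smul_mem_unitary hS c) h, smul_smul, ← Complex.exp_add]
  simp

theorem continuousOn_logAt (c : ℝ) : ContinuousOn (logAt c : Matrix n n ℂ → Matrix n n ℂ)
    {S | S ∈ unitary (Matrix n n ℂ) ∧ ‖Complex.exp (-(c * I)) • S - 1‖ < 2} := by
  refine ContinuousOn.add ?_ continuousOn_const
  exact continuousOn_argU.comp (continuous_const_smul _).continuousOn
    fun S hS => ⟨exp_smul_mem_unitary hS.1 c, hS.2⟩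

theorem logAt_mem_logDomain {S : Matrix n n ℂ} (hS : S ∈ SymUnitary n) {c : ℝ}
    (h : ‖Complex.exp (-(c * I)) • S - 1‖ < 2) : ∃ k : ℤ, logAt c S ∈ logDomain n k := by
  have h1 : (logAt c S).IsHermitian := (argU_isHermitian _).add (real_smul_one_isHermitian c)
  have hdet := det_expI h1
  rw [expI_logAt hS.1 h, hS.2.2, eq_comm, Complex.exp_eq_one_iff] at hdet
  obtain ⟨k, hk⟩ := hdet
  refine ⟨k, h1, ?_, ?_, c, ?_⟩
  · rw [logAt, transpose_add, ← argU_transpose (exp_smul_mem_unitary hS.1 c) h, transpose_smul,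
      hS.2.1, transpose_smul, transpose_one]
  · have : (logAt c S).trace * I = (2 * Real.pi * k) * I := by rw [hk]; ring
    exact mul_right_cancel₀ I_ne_zero this
  · rw [logAt, add_sub_cancel_right]
    exact norm_argU_lt (exp_smul_mem_unitary hS.1 c) h

/-- Near `expI A` the local inverse is `logAt c`. It takes values of trace in `2πℤ`, and by
continuity this trace stays within `2π` of `2πk`, so it remains equal to `2πk`. -/
theorem isOpenMap_symExp (k : ℤ) : IsOpenMap (symExp (n := n) k) := by
  rw [isOpenMap_iff_nhds_le]
  rintro ⟨A, hA⟩
  obtain ⟨c, hc⟩ := hA.2.2.2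
  have hlog : logAt c (expI A) = A := logAt_expI hA.1 hc
  set O : Set (SymUnitary n) := {S | ‖Complex.exp (-(c * I)) • S.1 - 1‖ < 2}
  have hO : IsOpen O := by
    have h1 : Continuous fun M : Matrix n n ℂ => ‖Complex.exp (-(c * I)) • M - 1‖ :=
      ((continuous_const_smul _).sub continuous_const).norm
    exact isOpen_lt (h1.comp continuous_subtype_val) continuous_const
  have hAO : symExp k ⟨A, hA⟩ ∈ O := by
    change ‖Complex.exp (-(c * I)) • expI A - 1‖ < 2
    rw [← expI_sub_real]
    exact norm_expI_sub_one_lt (hA.1.sub (real_smul_one_isHermitian c)) hc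
  have hcont : ContinuousOn (fun S : SymUnitary n => logAt c S.1) O :=
    (continuousOn_logAt c).comp continuous_subtype_val.continuousOn fun S hS => ⟨S.2.1, hS⟩
  have hat : Filter.Tendsto (fun S : SymUnitary n => logAt c S.1) (nhds (symExp k ⟨A, hA⟩))
      (nhds A) := by
    have := (hcont.continuousAt (hO.mem_nhds hAO)).tendsto
    rwa [show logAt c (symExp k ⟨A, hA⟩).1 = A from hlog] at this
  have htr : ∀ᶠ S : SymUnitary n in nhds (symExp k ⟨A, hA⟩),
      |(logAt c S.1).trace.re - 2 * Real.pi * k| < 2 * Real.pi := by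
    have h1 : Filter.Tendsto (fun S : SymUnitary n => |(logAt c S.1).trace.re - 2 * Real.pi * k|)
        (nhds (symExp k ⟨A, hA⟩)) (nhds |A.trace.re - 2 * Real.pi * k|) := by
      have : Continuous fun M : Matrix n n ℂ => |M.trace.re - 2 * Real.pi * k| := by fun_prop
      exact (this.tendsto A).comp hat
    refine h1.eventually_lt_const ?_
    rw [hA.2.2.1]
    simp [Real.pi_pos]
  have hmem : ∀ᶠ S : SymUnitary n in nhds (symExp k ⟨A, hA⟩), logAt c S.1 ∈ logDomain n k := by
    filter_upwards [htr, hO.mem_nhds hAO] with S hS hSO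
    obtain ⟨l, hl⟩ := logAt_mem_logDomain S.2 hSO
    rw [hl.2.2.1] at hS
    have h2 : |2 * Real.pi * (l - k : ℝ)| < 2 * Real.pi * 1 := by
      have : (2 * Real.pi * l : ℂ).re = 2 * Real.pi * l := by
        rw [show (2 * Real.pi * l : ℂ) = ((2 * Real.pi * l : ℝ) : ℂ) by push_cast; rfl,
          Complex.ofReal_re]
      rw [this] at hS
      rw [mul_sub, mul_one]
      exact hS
    rw [abs_mul, abs_of_pos Real.two_pi_pos] at h2
    have h3 := lt_of_mul_lt_mul_left h2 Real.two_pi_pos.le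
    have h4 : |l - k| < 1 := by exact_mod_cast h3
    have h5 : l = k := by
      have := Int.abs_lt_one_iff.mp h4
      omega
    rwa [h5] at hl
  intro V hV
  rw [Filter.mem_map] at hV
  rw [mem_nhds_subtype] at hV
  obtain ⟨W, hW, hWV⟩ := hV
  filter_upwards [hmem, hat hW, hO.mem_nhds hAO] with S h1 h2 h3
  have h4 : symExp k ⟨logAt c S.1, h1⟩ = S := Subtype.ext (expI_logAt S.2.1 h3)
  rw [← h4]
  exact hWV (show (⟨logAt c S.1, h1⟩ : logDomain n k) ∈ Subtype.val ⁻¹' W from h2)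

theorem isOpenEmbedding_symExp (k : ℤ) : Topology.IsOpenEmbedding (symExp (n := Fin 3) k) :=
  .of_continuous_injective_isOpenMap (continuous_symExp k) (symExp_injective k)
    (isOpenMap_symExp k)

theorem isSimplyConnected_range_symExp (k : ℤ) :
    IsSimplyConnected (Set.range (symExp (n := Fin 3) k)) := by
  have : ContractibleSpace (logDomain (Fin 3) k) :=
    (convex_logDomain k).contractibleSpace (logDomain_nonempty k)
  have h : SimplyConnectedSpace (logDomain (Fin 3) k) := inferInstance
  exact ((isOpenEmbedding_symExp k).toIsEmbedding.toHomeomorph.toHomotopyEquiv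
    ).simplyConnectedSpace_iff.mp h

end SymmetricUnitary

/-! ### The three charts cover, meet well, and give simple connectedness. -/

section SymmetricUnitaryTopology

open Matrix Complex

variable {n : Type*} [Fintype n] [DecidableEq n]

theorem conj_rdiag_mem_logDomain [Nonempty n] {U : Matrix n n ℂ} (hU : U ∈ unitary (Matrix n n ℂ))
    (hUs : star U = Uᵀ) {a : n → ℝ} (ha : ∀ i j, a i - a j < 2 * Real.pi) {k : ℤ}
    (hsum : ∑ i, a i = 2 * Real.pi * k) : U * rdiag a * star U ∈ logDomain n k := by
  refine ⟨conj_rdiag_isHermitian U a, ?_, ?_, ?_⟩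
  · have hd : (rdiag a)ᵀ = rdiag a := by simp [rdiag]
    rw [hUs, transpose_mul, transpose_mul, hd, transpose_transpose, mul_assoc]
  · rw [trace_conj_rdiag hU, hsum]; push_cast; rfl
  · obtain ⟨i, hi⟩ := Finite.exists_max a
    obtain ⟨j, hj⟩ := Finite.exists_min a
    refine ⟨(a i + a j) / 2, ?_⟩
    rw [conj_rdiag_sub_smul hU, norm_unitary_conj hU, norm_rdiag_lt_iff]
    intro l
    rw [abs_lt]
    constructor <;> linarith [hi l, hj l, ha i j]

/-- Adding `2πm` to every eigenvalue leaves the exponential unchanged and raises the trace by `2πm`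
times the size. Hence the index of a chart matters only modulo the size. -/
theorem range_symExp_subset (k m : ℤ) :
    Set.range (symExp (n := n) k) ⊆ Set.range (symExp (n := n) (k + Fintype.card n * m)) := by
  rintro _ ⟨⟨A, hA, hs, ht, c, hc⟩, rfl⟩
  have hB : A + ((2 * Real.pi * m : ℝ) : ℂ) • 1 ∈ logDomain n (k + Fintype.card n * m) := by
    refine ⟨hA.add (real_smul_one_isHermitian _), by simp [hs], ?_, c + 2 * Real.pi * m, ?_⟩
    · rw [trace_add, real_smul_one_trace, ht]; push_cast; ring
    · have : A + ((2 * Real.pi * m : ℝ) : ℂ) • 1 - ((c + 2 * Real.pi * m : ℝ) : ℂ) • 1 =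
          A - (c : ℂ) • 1 := by
        push_cast; rw [add_smul]; abel
      rwa [this]
  refine ⟨⟨_, hB⟩, Subtype.ext ?_⟩
  change expI (A + ((2 * Real.pi * m : ℝ) : ℂ) • 1) = expI A
  rw [expI_add_real]
  have : (((2 * Real.pi * m : ℝ) : ℂ) * I) = m * (2 * Real.pi * I) := by push_cast; ring
  rw [this, Complex.exp_int_mul_two_pi_mul_I, one_smul]

theorem range_symExp_periodic (k m : ℤ) :
    Set.range (symExp (n := n) (k + Fintype.card n * m)) = Set.range (symExp (n := n) k) := by
  refine Set.Subset.antisymm ?_ (range_symExp_subset k m)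
  have := range_symExp_subset (n := n) (k + Fintype.card n * m) (-m)
  rwa [mul_neg, add_neg_cancel_right] at this

/-- The spectrum is finite, so some point of the unit circle is not an eigenvalue; a rotation moves
this point to `-1`. -/
theorem exists_norm_exp_smul_sub_one_lt {S : Matrix n n ℂ} (hS : S ∈ unitary (Matrix n n ℂ)) :
    ∃ c : ℝ, ‖Complex.exp (-(c * I)) • S - 1‖ < 2 := by
  have hinf : ((fun c : ℝ => -Complex.exp (c * I)) '' Set.Ioo 0 1).Infinite := by
    refine Set.Infinite.image ?_ (Set.Ioo_infinite one_pos)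
    intro x hx y hy hxy
    have h1 : Circle.exp x = Circle.exp y := by
      ext
      simpa using hxy
    have hpi := Real.pi_gt_three
    have h2 : arg (Circle.exp x : ℂ) = arg (Circle.exp y : ℂ) := by rw [h1]
    rwa [Circle.arg_exp (by linarith [hx.1]) (by linarith [hx.2]),
      Circle.arg_exp (by linarith [hy.1]) (by linarith [hy.2])] at h2
  obtain ⟨_, ⟨c, -, rfl⟩, hc⟩ := hinf.exists_notMem_finite (Matrix.finite_spectrum S)
  refine ⟨c, ?_⟩
  rw [Unitary.norm_sub_one_lt_two_iff (exp_smul_mem_unitary hS c)]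
  rw [spectrum.notMem_iff] at hc ⊢
  have : algebraMap ℂ (Matrix n n ℂ) (-1) - Complex.exp (-(c * I)) • S =
      Complex.exp (-(c * I)) • (algebraMap ℂ (Matrix n n ℂ) (-Complex.exp (c * I)) - S) := by
    rw [smul_sub, Algebra.algebraMap_eq_smul_one, Algebra.algebraMap_eq_smul_one, smul_smul,
      mul_neg, ← Complex.exp_add, neg_add_cancel, Complex.exp_zero]
  rw [this]
  exact (isUnit_smul_iff (Units.mk0 _ (Complex.exp_ne_zero (-(c * I)))) _).mpr hc

theorem exists_mem_range_symExp (S : SymUnitary n) : ∃ k : ℤ, S ∈ Set.range (symExp (n := n) k) := by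
  obtain ⟨c, hc⟩ := exists_norm_exp_smul_sub_one_lt S.2.1
  obtain ⟨k, hk⟩ := logAt_mem_logDomain S.2 hc
  exact ⟨k, ⟨_, hk⟩, Subtype.ext (expI_logAt S.2.1 hc)⟩

/-- The tuples of eigenvalue arguments, with `a j` strictly the smallest, of the matrices in the
intersection of the charts of index `k` and `k + 1`. -/
def simpleTuples (k : ℤ) (j : n) : Set (n → ℝ) :=
  {a | (∀ i ≠ j, a j < a i ∧ a i < a j + 2 * Real.pi) ∧ ∑ i, a i = 2 * Real.pi * k}

omit [DecidableEq n] in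
theorem convex_simpleTuples (k : ℤ) (j : n) : Convex ℝ (simpleTuples k j) := by
  rintro a ⟨ha, hs⟩ b ⟨hb, hs'⟩ x y hx hy hxy
  refine ⟨fun i hi => ?_, ?_⟩
  · simp only [Pi.add_apply, Pi.smul_apply, smul_eq_mul]
    obtain ⟨h1, h2⟩ := ha i hi
    obtain ⟨h3, h4⟩ := hb i hi
    have hxy' : y = 1 - x := by linarith
    -- The inequalities are strict, so one weight must be positive; the case `x = 0` is treated
    -- apart.
    rcases hx.eq_or_lt with h | h
    · subst h
      have : y = 1 := by linarith
      subst this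
      constructor <;> linarith
    · constructor
      · nlinarith [mul_lt_mul_of_pos_left h1 h, mul_le_mul_of_nonneg_left h3.le hy]
      · have := mul_lt_mul_of_pos_left h2 h
        have := mul_le_mul_of_nonneg_left h4.le hy
        have : 2 * Real.pi = x * (2 * Real.pi) + y * (2 * Real.pi) := by
          rw [← add_mul, hxy, one_mul]
        linarith
  · simp only [Pi.add_apply, Pi.smul_apply, smul_eq_mul]
    rw [Finset.sum_add_distrib, ← Finset.mul_sum, ← Finset.mul_sum, hs, hs', ← add_mul, hxy, one_mul]

/-- Raising the strictly smallest argument `a j` by `2π` makes it the largest, keeps the spread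
below `2π`, and turns a logarithm of index `k` into one of index `k + 1`. -/
theorem mem_range_symExp_of_mem_simpleTuples {U : Matrix n n ℂ} (hU : U ∈ unitary (Matrix n n ℂ))
    (hUs : star U = Uᵀ) {k : ℤ} {j : n} {a : n → ℝ} (ha : a ∈ simpleTuples k j)
    {S : SymUnitary n} (hS : S.1 = expI (U * rdiag a * star U)) :
    S ∈ Set.range (symExp (n := n) k) ∩ Set.range (symExp (n := n) (k + 1)) := by
  have := Nonempty.intro j
  obtain ⟨h, hsum⟩ := ha
  have hpi := Real.pi_pos
  constructor
  · refine ⟨⟨_, conj_rdiag_mem_logDomain hU hUs (a := a) (fun i i' => ?_) hsum⟩,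
      Subtype.ext hS.symm⟩
    by_cases hi : i = j <;> by_cases hi' : i' = j
    · subst hi; subst hi'; linarith
    · subst hi; linarith [(h i' hi').1]
    · subst hi'; linarith [(h i hi).2]
    · linarith [(h i' hi').1, (h i hi).2]
  · refine ⟨⟨_, conj_rdiag_mem_logDomain hU hUs
      (a := fun i => a i + if i = j then 2 * Real.pi else 0) (fun i i' => ?_) ?_⟩,
      Subtype.ext ?_⟩
    · by_cases hi : i = j <;> by_cases hi' : i' = j
      · subst hi; subst hi'; linarith
      · subst hi; simp only [hi', if_true, if_false]; linarith [(h i' hi').1]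
      · subst hi'; simp only [hi, if_true, if_false]; linarith [(h i hi).2]
      · simp only [hi, hi', if_false]; linarith [(h i' hi').1, (h i hi).2]
    · rw [Finset.sum_add_distrib, hsum]
      simp; ring
    · change expI _ = S.1
      rw [hS, expI_conj_rdiag hU, expI_conj_rdiag hU]
      congr 3
      ext i
      by_cases hi : i = j
      · simp only [hi, if_true]
        have : ((a j + 2 * Real.pi : ℝ) * I : ℂ) = a j * I + 2 * Real.pi * I := by push_cast; ring
        rw [this, Complex.exp_add, Complex.exp_two_pi_mul_I, mul_one]
      · simp [hi]

/-- For logarithms of indices `k` and `k + 1` the shifts satisfy `∑ m i = 1` and differ pairwise by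
at most one. Exactly one shift is therefore 1 and the others are 0, and the two spectral bounds make
the shifted eigenvalue the strictly smallest one. -/
theorem exists_mem_simpleTuples {k : ℤ} {S : SymUnitary (Fin 3)}
    (hS : S ∈ Set.range (symExp (n := Fin 3) k) ∩ Set.range (symExp (n := Fin 3) (k + 1))) :
    ∃ U ∈ unitary (Matrix (Fin 3) (Fin 3) ℂ), star U = Uᵀ ∧ ∃ j, ∃ a ∈ simpleTuples k j,
      S.1 = expI (U * rdiag a * star U) := by
  obtain ⟨⟨⟨A, hA, hs, ht, c, hc⟩, rfl⟩, ⟨⟨B, hB, hs', ht', c', hc'⟩, h⟩⟩ := hS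
  have he : expI A = expI B := congrArg Subtype.val h.symm
  obtain ⟨U, hU, hUs, a, m, rfl, rfl, h1, h2⟩ := exists_common_diagonalization hA hs hB hc hc' he
  rw [trace_conj_rdiag hU] at ht ht'
  have ht1 : ∑ i, a i = 2 * Real.pi * k := by exact_mod_cast ht
  have hsum : ∑ i, m i = 1 := by
    have h3 : ∑ i, (a i + 2 * Real.pi * m i) = 2 * Real.pi * (k + 1 : ℤ) := by exact_mod_cast ht'
    rw [Finset.sum_add_distrib, ← Finset.mul_sum, ht1] at h3
    have h4 : 2 * Real.pi * ∑ i, (m i : ℝ) = 2 * Real.pi * 1 := by push_cast at h3; linarith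
    have h5 := mul_left_cancel₀ Real.two_pi_pos.ne' h4
    exact_mod_cast h5
  have hd (i j : Fin 3) : m i - m j < 2 := int_abs_sub_lt_two (h1 i) (h1 j) (h2 i) (h2 j)
  have hm : ∃ j, m j = 1 ∧ ∀ i ≠ j, m i = 0 := by
    rw [Fin.sum_univ_three] at hsum
    have := hd 0 1; have := hd 1 0; have := hd 0 2; have := hd 2 0; have := hd 1 2; have := hd 2 1
    by_cases h0 : m 0 = 1
    · refine ⟨0, h0, fun i hi => ?_⟩
      fin_cases i <;> simp only [Fin.zero_eta, Fin.mk_one, Fin.reduceFinMk] at hi ⊢ <;> omega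
    by_cases h1 : m 1 = 1
    · refine ⟨1, h1, fun i hi => ?_⟩
      fin_cases i <;> simp only [Fin.zero_eta, Fin.mk_one, Fin.reduceFinMk] at hi ⊢ <;> omega
    refine ⟨2, by omega, fun i hi => ?_⟩
    fin_cases i <;> simp only [Fin.zero_eta, Fin.mk_one, Fin.reduceFinMk] at hi ⊢ <;> omega
  obtain ⟨j, hj, hij⟩ := hm
  refine ⟨U, hU, hUs, j, a, ⟨fun i hi => ?_, ht1⟩, rfl⟩
  have e1 := h1 i; have e2 := h1 j; have e3 := h2 i; have e4 := h2 j
  rw [hj] at e4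
  rw [hij i hi] at e3
  rw [abs_lt] at e1 e2 e3 e4
  push_cast at e3 e4
  constructor <;> linarith [e1.1, e1.2, e2.1, e2.2, e3.1, e3.2, e4.1, e4.2]

theorem continuous_conj_rdiag (U : Matrix n n ℂ) :
    Continuous fun a : n → ℝ => expI (U * rdiag a * star U) := by
  refine continuous_expI.comp ?_
  have : Continuous fun a : n → ℝ => rdiag a := by
    unfold rdiag
    fun_prop
  exact (continuous_const.mul this).mul continuous_const

/-- The matrix with eigenvalues `α - π` on the line of the real vector `v`, `α` on its
orthogonal complement. -/
noncomputable def poleMatrix (α : ℝ) (v : EuclideanSpace ℝ n) : Matrix n n ℂ :=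
  (α : ℂ) • 1 - (Real.pi : ℂ) • Matrix.of fun p q => ((v p * v q : ℝ) : ℂ)

theorem poleMatrix_eq {U : Matrix n n ℂ} (hU : U ∈ unitary (Matrix n n ℂ)) {α : ℝ} {j : n}
    {v : EuclideanSpace ℝ n} (hv : ∀ i, U i j = (v i : ℂ)) :
    poleMatrix α v = U * rdiag (fun i => α - if i = j then Real.pi else 0) * star U := by
  have h1 : rdiag (fun i => α - if i = j then Real.pi else 0) =
      (α : ℂ) • 1 - (Real.pi : ℂ) • diagonal (Pi.single j (1 : ℂ)) := by
    ext p q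
    by_cases h : p = q
    · subst h
      by_cases h' : p = j
      · subst h'; simp [rdiag]
      · simp [rdiag, h']
    · simp [rdiag, h]
  rw [h1, mul_sub, sub_mul, mul_smul_comm, mul_one, smul_mul_assoc,
    Unitary.mul_star_self_of_mem hU, poleMatrix]
  congr 1
  rw [mul_smul_comm, smul_mul_assoc]
  congr 1
  ext p q
  rw [Matrix.mul_apply, Finset.sum_eq_single j]
  · simp [hv]
  · intro b _ hb
    simp [hb]
  · simp

theorem exists_orthogonal_column {v : EuclideanSpace ℝ n} (hv : ‖v‖ = 1) (j : n) :
    ∃ U ∈ unitary (Matrix n n ℂ), star U = Uᵀ ∧ ∀ i, U i j = (v i : ℂ) := by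
  have ho : Orthonormal ℝ (({j} : Set n).domRestrict fun _ : n => v) := by
    constructor
    · intro i; simpa using hv
    · rintro ⟨a, ha⟩ ⟨b, hb⟩ hab
      exact absurd (Subtype.ext (ha.trans hb.symm)) hab
  obtain ⟨b, hb⟩ := ho.exists_orthonormalBasis_extension_of_card_eq (by simp)
  have hb' : b j = v := hb j rfl
  have hst : star (Matrix.of fun p q => ((b q p : ℝ) : ℂ)) *
      (Matrix.of fun p q => ((b q p : ℝ) : ℂ)) = 1 := by
    ext p q
    have h := b.inner_eq_ite p q
    rw [PiLp.inner_apply] at h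
    have h' : ∑ x, ((b p x : ℝ) : ℂ) * ((b q x : ℝ) : ℂ) = if p = q then 1 else 0 := by
      have h3 : ∑ x, b p x * b q x = if p = q then 1 else 0 := by
        rw [← h]; simp [mul_comm]
      have := congrArg Complex.ofReal h3
      push_cast at this
      rw [this]
      split_ifs <;> simp
    rw [Matrix.mul_apply]
    simpa [Matrix.one_apply] using h'
  refine ⟨Matrix.of fun p q => ((b q p : ℝ) : ℂ), ?_, ?_, fun i => ?_⟩
  · rw [Unitary.mem_iff]
    exact ⟨hst, mul_eq_one_comm.mp hst⟩
  · ext p q; simp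
  · simp [hb']

theorem exists_column {U : Matrix n n ℂ} (hU : U ∈ unitary (Matrix n n ℂ)) (hUs : star U = Uᵀ)
    (j : n) : ∃ v : EuclideanSpace ℝ n, ‖v‖ = 1 ∧ ∀ i, U i j = (v i : ℂ) := by
  have hreal (i : n) : U i j = ((U i j).re : ℂ) := by
    have := congrFun (congrFun hUs j) i
    simp only [star_apply, transpose_apply] at this
    exact (Complex.conj_eq_iff_re.mp this).symm
  refine ⟨WithLp.toLp 2 fun i => (U i j).re, ?_, fun i => hreal i⟩
  have h1 : (star U * U) j j = (1 : Matrix n n ℂ) j j := by rw [Unitary.star_mul_self_of_mem hU]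
  rw [Matrix.mul_apply, hUs] at h1
  simp only [transpose_apply, one_apply_eq] at h1
  have h2 : ∑ i, (U i j).re * (U i j).re = 1 := by
    have h3 : ∑ i, (((U i j).re : ℂ) * ((U i j).re : ℂ)) = 1 := by
      rw [← h1]
      exact Finset.sum_congr rfl fun i _ => by rw [← hreal i]
    exact_mod_cast h3
  rw [EuclideanSpace.norm_eq, Real.sqrt_eq_one]
  simpa [sq] using h2

theorem pole_mem_simpleTuples (k : ℤ) (j : Fin 3) :
    (fun i => 2 * Real.pi * k / 3 + Real.pi / 3 - if i = j then Real.pi else 0) ∈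
      simpleTuples k j := by
  have := Real.pi_pos
  refine ⟨fun i hi => ?_, ?_⟩
  · simp only [hi, if_true, if_false]
    constructor <;> linarith
  · rw [Finset.sum_sub_distrib]
    simp
    ring

/-- A matrix in the overlap singles out the real line of its smallest argument. Moving the arguments
in the convex set `simpleTuples k j` with fixed eigenvectors leads to a matrix determined by this
line alone, and such matrices are parametrized by the unit sphere of `ℝ³`, which is path connected.
-/
theorem isPathConnected_inter_range_symExp (k : ℤ) :
    IsPathConnected (Set.range (symExp (n := Fin 3) k) ∩ Set.range (symExp (n := Fin 3) (k + 1))) := by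
  -- The arguments `α - π, α, α` must have sum `2πk`, which determines `α`.
  set α : ℝ := 2 * Real.pi * k / 3 + Real.pi / 3 with hα
  have hpole (v : Metric.sphere (0 : EuclideanSpace ℝ (Fin 3)) 1) :
      expI (poleMatrix α v) ∈ SymUnitary (Fin 3) := by
    obtain ⟨U, hU, hUs, hv⟩ := exists_orthogonal_column (mem_sphere_zero_iff_norm.mp v.2) 0
    rw [poleMatrix_eq hU hv]
    refine expI_mem_symUnitary (k := k) (conj_rdiag_mem_logDomain hU hUs (fun i i' => ?_)
      (pole_mem_simpleTuples k 0).2)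
    have := Real.pi_pos
    split_ifs <;> linarith
  let pole (v : Metric.sphere (0 : EuclideanSpace ℝ (Fin 3)) 1) : SymUnitary (Fin 3) :=
    ⟨expI (poleMatrix α v), hpole v⟩
  have hpole_cont : Continuous pole := by
    refine Continuous.subtype_mk (continuous_expI.comp ?_) _
    have : Continuous fun v : EuclideanSpace ℝ (Fin 3) =>
        (Matrix.of fun p q => ((v p * v q : ℝ) : ℂ) : Matrix (Fin 3) (Fin 3) ℂ) := by
      refine continuous_matrix fun p q => ?_
      simp only [of_apply]
      fun_prop
    have h2 : Continuous fun v : EuclideanSpace ℝ (Fin 3) => poleMatrix α v :=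
      continuous_const.sub ((continuous_const_smul (Real.pi : ℂ)).comp this)
    exact h2.comp continuous_subtype_val
  have hpole_mem (v) : pole v ∈
      Set.range (symExp (n := Fin 3) k) ∩ Set.range (symExp (n := Fin 3) (k + 1)) := by
    obtain ⟨U, hU, hUs, hv⟩ := exists_orthogonal_column (mem_sphere_zero_iff_norm.mp v.2) 0
    exact mem_range_symExp_of_mem_simpleTuples hU hUs (pole_mem_simpleTuples k 0)
      (congrArg expI (poleMatrix_eq hU hv))
  have hrange : IsPathConnected (Set.range pole) := by
    have h1 : IsPathConnected (Metric.sphere (0 : EuclideanSpace ℝ (Fin 3)) 1) := by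
      refine isPathConnected_sphere ?_ _ zero_le_one
      rw [← Module.finrank_eq_rank]
      simp
    have : PathConnectedSpace (Metric.sphere (0 : EuclideanSpace ℝ (Fin 3)) 1) :=
      isPathConnected_iff_pathConnectedSpace.mp h1
    exact isPathConnected_range hpole_cont
  have hjoin : ∀ S ∈ Set.range (symExp (n := Fin 3) k) ∩ Set.range (symExp (n := Fin 3) (k + 1)),
      ∃ v, JoinedIn
        (Set.range (symExp (n := Fin 3) k) ∩ Set.range (symExp (n := Fin 3) (k + 1))) S (pole v) := by
    intro S hS
    obtain ⟨U, hU, hUs, j, a, ha, hSa⟩ := exists_mem_simpleTuples hS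
    obtain ⟨v, hv1, hv⟩ := exists_column hU hUs j
    have hmem (b : simpleTuples k j) : expI (U * rdiag b.1 * star U) ∈ SymUnitary (Fin 3) := by
      refine expI_mem_symUnitary (k := k) (conj_rdiag_mem_logDomain hU hUs (fun i i' => ?_) b.2.2)
      have hpi := Real.pi_pos
      have h := b.2.1
      by_cases hi : i = j <;> by_cases hi' : i' = j
      · subst hi; subst hi'; linarith
      · subst hi; linarith [(h i' hi').1]
      · subst hi'; linarith [(h i hi).2]
      · linarith [(h i' hi').1, (h i hi).2]
    let g (b : simpleTuples k j) : SymUnitary (Fin 3) := ⟨expI (U * rdiag b.1 * star U), hmem b⟩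
    have hg : Continuous g :=
      ((continuous_conj_rdiag U).comp continuous_subtype_val).subtype_mk _
    have : PathConnectedSpace (simpleTuples k j) :=
      isPathConnected_iff_pathConnectedSpace.mp
        ((convex_simpleTuples k j).isPathConnected ⟨a, ha⟩)
    have hgr := isPathConnected_range hg
    refine ⟨⟨v, mem_sphere_zero_iff_norm.mpr hv1⟩, ?_⟩
    have h1 : g ⟨a, ha⟩ = S := Subtype.ext hSa.symm
    have h2 : g ⟨_, pole_mem_simpleTuples k j⟩ = pole ⟨v, mem_sphere_zero_iff_norm.mpr hv1⟩ :=
      Subtype.ext (congrArg expI (poleMatrix_eq hU hv).symm)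
    rw [← h1, ← h2]
    refine (hgr.joinedIn _ ⟨_, rfl⟩ _ ⟨_, rfl⟩).mono ?_
    rintro _ ⟨b, rfl⟩
    exact mem_range_symExp_of_mem_simpleTuples hU hUs b.2 rfl
  obtain ⟨v₀⟩ : Nonempty (Metric.sphere (0 : EuclideanSpace ℝ (Fin 3)) 1) :=
    (NormedSpace.sphere_nonempty.mpr zero_le_one).to_subtype
  refine ⟨pole v₀, hpole_mem v₀, fun {S} hS => ?_⟩
  obtain ⟨v, hv⟩ := hjoin S hS
  refine JoinedIn.trans ?_ hv.symm
  refine (hrange.joinedIn _ ⟨v₀, rfl⟩ _ ⟨v, rfl⟩).mono ?_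
  rintro _ ⟨w, rfl⟩
  exact hpole_mem w

theorem simplyConnectedSpace_symUnitary : SimplyConnectedSpace (SymUnitary (Fin 3)) := by
  have hpi := Real.pi_pos
  have hper (k : ℤ) (m : ℤ) : Set.range (symExp (n := Fin 3) (k + 3 * m)) =
      Set.range (symExp (n := Fin 3) k) :=
    range_symExp_periodic (n := Fin 3) k m
  have hmem (a : Fin 3 → ℝ) (ha : ∀ i j, a i - a j < 2 * Real.pi) (k : ℤ)
      (hk : ∑ i, a i = 2 * Real.pi * k) : rdiag a ∈ logDomain (Fin 3) k := by
    simpa using conj_rdiag_mem_logDomain (one_mem (unitary (Matrix (Fin 3) (Fin 3) ℂ))) (by simp)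
      ha hk
  -- The eigenvalues are the three distinct cube roots of unity. Raising the smallest argument by
  -- `2π` once and then twice gives logarithms of indices 1 and 2, so this point lies in all three
  -- charts.
  let x₀ : SymUnitary (Fin 3) :=
    symExp 0 ⟨rdiag ![-(2 * Real.pi / 3), 0, 2 * Real.pi / 3], hmem _ (fun i j => by
      fin_cases i <;> fin_cases j <;> simp <;> linarith) 0 (by simp [Fin.sum_univ_three])⟩
  refine simplyConnectedSpace_of_open_cover
    (fun i : Fin 3 => Set.range (symExp (n := Fin 3) (i : ℕ)))
    (fun i => (isOpenEmbedding_symExp _).isOpen_range) (fun S => ?_) x₀ (fun i => ?_)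
    (fun i => isSimplyConnected_range_symExp _) (fun i j => ?_)
  · obtain ⟨k, hk⟩ := exists_mem_range_symExp S
    have h3 : k % 3 + 3 * (k / 3) = k := Int.emod_add_mul_ediv k 3
    rw [← h3, hper] at hk
    refine ⟨⟨(k % 3).toNat, by omega⟩, ?_⟩
    have h4 : (((k % 3).toNat : ℕ) : ℤ) = k % 3 := Int.toNat_of_nonneg (by omega)
    have h5 : Set.range (symExp (n := Fin 3) ((k % 3).toNat : ℕ)) =
        Set.range (symExp (n := Fin 3) (k % 3)) := by rw [h4]
    rwa [← h5] at hk
  · have hexp (x : ℝ) : Complex.exp ((x + 2 * Real.pi : ℝ) * I) = Complex.exp (x * I) := by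
      have : ((x + 2 * Real.pi : ℝ) * I : ℂ) = x * I + 2 * Real.pi * I := by push_cast; ring
      rw [this, Complex.exp_add, Complex.exp_two_pi_mul_I, mul_one]
    have e1 := hexp (-(2 * Real.pi / 3))
    have e2 := hexp 0
    fin_cases i
    · exact ⟨_, rfl⟩
    · refine ⟨⟨rdiag ![-(2 * Real.pi / 3) + 2 * Real.pi, 0, 2 * Real.pi / 3], hmem _ (fun i j => by
        fin_cases i <;> fin_cases j <;> simp <;> linarith) _ (by
          simp [Fin.sum_univ_three])⟩, Subtype.ext ?_⟩
      change expI _ = expI _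
      rw [expI_rdiag, expI_rdiag]
      congr 1
      ext i
      fin_cases i
      · exact e1
      · rfl
      · rfl
    · refine ⟨⟨rdiag ![-(2 * Real.pi / 3) + 2 * Real.pi, 0 + 2 * Real.pi, 2 * Real.pi / 3],
        hmem _ (fun i j => by fin_cases i <;> fin_cases j <;> simp <;> linarith) _ (by
          simp [Fin.sum_univ_three]; ring)⟩, Subtype.ext ?_⟩
      change expI _ = expI _
      rw [expI_rdiag, expI_rdiag]
      congr 1
      ext i
      fin_cases i
      · exact e1
      · exact e2
      · rfl
  · have h01 := isPathConnected_inter_range_symExp 0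
    have h12 := isPathConnected_inter_range_symExp 1
    have h20 := isPathConnected_inter_range_symExp 2
    -- The overlap of charts 2 and 0 is the overlap of the consecutive charts 2 and 3.
    have h3 : Set.range (symExp (n := Fin 3) (2 + 1)) = Set.range (symExp (n := Fin 3) 0) :=
      hper 0 1
    rw [h3] at h20
    have hself (k : ℤ) : IsPathConnected (Set.range (symExp (n := Fin 3) k) ∩
        Set.range (symExp (n := Fin 3) k)) := by
      rw [Set.inter_self]
      exact (isSimplyConnected_range_symExp k).isPathConnected
    fin_cases i <;> fin_cases j
    · exact hself 0
    · exact h01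
    · rw [Set.inter_comm]; exact h20
    · rw [Set.inter_comm]; exact h01
    · exact hself 1
    · exact h12
    · exact h20
    · rw [Set.inter_comm]; exact h12
    · exact hself 2

end SymmetricUnitaryTopology

/-! ### Special Lagrangian planes as symmetric special unitary matrices. -/

section SpecialLagrangianModel

open Matrix Complex

variable {n : ℕ}

/-- The antilinear map `v ↦ S v̄` of `ℂⁿ`, as a real linear map. -/
noncomputable def antiMap (S : Matrix (Fin n) (Fin n) ℂ) : Cn n →L[ℝ] Cn n :=
  LinearMap.toContinuousLinearMap
    { toFun := fun v => WithLp.toLp 2 (S *ᵥ star v.ofLp)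
      map_add' := fun u v => by ext i; simp [mulVec_add]
      map_smul' := fun c v => by
        ext i
        simp [mulVec, dotProduct, Finset.mul_sum]
        exact Finset.sum_congr rfl fun j _ => by ring }

theorem antiMap_apply (S : Matrix (Fin n) (Fin n) ℂ) (v : Cn n) :
    antiMap S v = WithLp.toLp 2 (S *ᵥ star v.ofLp) := rfl

/-- The real subspace of the fixed vectors of `v ↦ S v̄`. -/
noncomputable def fixedPlane (S : Matrix (Fin n) (Fin n) ℂ) : Submodule ℝ (Cn n) :=
  LinearMap.eqLocus (antiMap S : Cn n →ₗ[ℝ] Cn n) LinearMap.id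

theorem mem_fixedPlane {S : Matrix (Fin n) (Fin n) ℂ} {v : Cn n} :
    v ∈ fixedPlane S ↔ antiMap S v = v := Iff.rfl

theorem mul_map_star_eq_one {S : Matrix (Fin n) (Fin n) ℂ} (hS : S ∈ SymUnitary (Fin n)) :
    S * S.map star = 1 := by
  have h : S.map star = star S := by
    conv_rhs => rw [← hS.2.1]
    ext i j; simp
  rw [h, Unitary.mul_star_self_of_mem hS.1]

theorem star_mulVec' (S : Matrix (Fin n) (Fin n) ℂ) (v : Fin n → ℂ) :
    star (S *ᵥ v) = S.map star *ᵥ star v := by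
  ext i
  simp [mulVec, dotProduct]

theorem antiMap_antiMap {S : Matrix (Fin n) (Fin n) ℂ} (hS : S ∈ SymUnitary (Fin n)) (v : Cn n) :
    antiMap S (antiMap S v) = v := by
  rw [antiMap_apply, antiMap_apply]
  simp only [star_mulVec', star_star, mulVec_mulVec, mul_map_star_eq_one hS, one_mulVec]

theorem inner_antiMap {S : Matrix (Fin n) (Fin n) ℂ} (hS : S ∈ unitary (Matrix (Fin n) (Fin n) ℂ))
    (u v : Cn n) : inner ℂ (antiMap S u) (antiMap S v) = star (inner ℂ u v) := by
  rw [EuclideanSpace.inner_eq_star_dotProduct, EuclideanSpace.inner_eq_star_dotProduct,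
    antiMap_apply, antiMap_apply]
  simp only
  rw [star_mulVec, star_star, dotProduct_comm, dotProduct_mulVec, vecMul_vecMul,
    ← star_eq_conjTranspose, Unitary.star_mul_self_of_mem hS, vecMul_one, ← star_dotProduct_star,
    star_star]

theorem real_inner_eq_re (u v : Cn n) : inner ℝ u v = (inner ℂ u v : ℂ).re := by
  simp [PiLp.inner_apply, Complex.inner]

/-- The map `antiMap S` is an isometric involution, so the mean of the identity and `antiMap S`
projects orthogonally onto its fixed vectors. The topology of `SLG n` thereby becomes that of the
matrices. -/
theorem starProjection_fixedPlane {S : Matrix (Fin n) (Fin n) ℂ} (hS : S ∈ SymUnitary (Fin n)) :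
    (fixedPlane S).starProjection = (1 / 2 : ℝ) • (ContinuousLinearMap.id ℝ (Cn n) + antiMap S) := by
  ext1 u
  refine Submodule.eq_starProjection_of_mem_of_inner_eq_zero (K := fixedPlane S) ?_ ?_
  · rw [mem_fixedPlane]
    simp [antiMap_antiMap hS, add_comm]
  · intro w hw
    rw [mem_fixedPlane] at hw
    have h1 := inner_antiMap hS.1 u w
    rw [hw] at h1
    have h2 : inner ℝ (antiMap S u) w = inner ℝ u w := by
      rw [real_inner_eq_re, real_inner_eq_re, h1]
      exact Complex.conj_re _
    have h3 : u - ((1 / 2 : ℝ) • (ContinuousLinearMap.id ℝ (Cn n) + antiMap S)) u =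
        (1 / 2 : ℝ) • (u - antiMap S u) := by
      simp only [_root_.smul_apply, _root_.add_apply,
        ContinuousLinearMap.id_apply]
      module
    rw [h3, inner_smul_left, inner_sub_left, h2]
    simp

/-- The real linear map `x ↦ W x` from `ℝⁿ` to `ℂⁿ`. -/
noncomputable def realColumns (W : Matrix (Fin n) (Fin n) ℂ) : (Fin n → ℝ) →ₗ[ℝ] Cn n where
  toFun x := WithLp.toLp 2 (W *ᵥ fun i => (x i : ℂ))
  map_add' x y := by
    ext i; simp [mulVec, dotProduct, mul_add, Finset.sum_add_distrib]
  map_smul' c x := by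
    ext i
    simp [mulVec, dotProduct, Finset.mul_sum]
    exact Finset.sum_congr rfl fun j _ => by ring

theorem realColumns_apply (W : Matrix (Fin n) (Fin n) ℂ) (x : Fin n → ℝ) :
    realColumns W x = WithLp.toLp 2 (W *ᵥ fun i => (x i : ℂ)) := rfl

theorem realColumns_injective {W : Matrix (Fin n) (Fin n) ℂ}
    (hW : W ∈ unitary (Matrix (Fin n) (Fin n) ℂ)) : Function.Injective (realColumns W) := by
  intro x y h
  have h1 : W *ᵥ (fun i => (x i : ℂ)) = W *ᵥ fun i => (y i : ℂ) := congrArg WithLp.ofLp h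
  have h2 := congrArg (fun v => star W *ᵥ v) h1
  simp only [mulVec_mulVec, Unitary.star_mul_self_of_mem hW, one_mulVec] at h2
  ext i
  exact_mod_cast congrFun h2 i

theorem range_realColumns {W : Matrix (Fin n) (Fin n) ℂ}
    (hW : W ∈ unitary (Matrix (Fin n) (Fin n) ℂ)) :
    LinearMap.range (realColumns W) = fixedPlane (W * Wᵀ) := by
  have hconj : Wᵀ * W.map star = 1 := by
    have h := congrArg transpose (Unitary.star_mul_self_of_mem hW)
    rw [transpose_mul, transpose_one] at h
    exact h
  ext v
  rw [mem_fixedPlane, antiMap_apply]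
  constructor
  · rintro ⟨x, rfl⟩
    rw [realColumns_apply]
    simp only
    congr 1
    rw [star_mulVec', mulVec_mulVec, mul_assoc, hconj, mul_one]
    congr 1
    ext i; simp
  · intro h
    have h1 : (W * Wᵀ) *ᵥ star v.ofLp = v.ofLp := congrArg WithLp.ofLp h
    have h2 : Wᵀ *ᵥ star v.ofLp = star W *ᵥ v.ofLp := by
      conv_rhs => rw [← h1]
      rw [mulVec_mulVec, ← mul_assoc, Unitary.star_mul_self_of_mem hW, one_mul]
    have h3 : star (star W *ᵥ v.ofLp) = star W *ᵥ v.ofLp := by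
      rw [star_mulVec', ← h2]
      congr 1
      ext i j; simp
    refine ⟨fun i => ((star W *ᵥ v.ofLp) i).re, ?_⟩
    have h4 : (fun i => ((((star W *ᵥ v.ofLp) i).re : ℝ) : ℂ)) = star W *ᵥ v.ofLp := by
      ext i
      exact Complex.conj_eq_iff_re.mp (congrFun h3 i)
    rw [realColumns_apply, h4, mulVec_mulVec, Unitary.mul_star_self_of_mem hW, one_mulVec]

theorem finrank_fixedPlane {W : Matrix (Fin n) (Fin n) ℂ}
    (hW : W ∈ unitary (Matrix (Fin n) (Fin n) ℂ)) :
    Module.finrank ℝ (fixedPlane (W * Wᵀ)) = n := by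
  rw [← range_realColumns hW, LinearMap.finrank_range_of_inj (realColumns_injective hW)]
  simp

/-- With `A` a symmetric logarithm of `S`, the matrix `exp (iA/2)` is symmetric and squares to `S`.
-/
theorem exists_unitary_mul_transpose {S : Matrix (Fin n) (Fin n) ℂ} (hS : S ∈ SymUnitary (Fin n)) :
    ∃ W ∈ unitary (Matrix (Fin n) (Fin n) ℂ), W * Wᵀ = S := by
  obtain ⟨k, ⟨A, hA⟩, h⟩ := exists_mem_range_symExp ⟨S, hS⟩
  have h : expI A = S := congrArg Subtype.val h
  have hB : ((1 / 2 : ℝ) • A).IsHermitian := hA.1.smul (IsSelfAdjoint.all _)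
  refine ⟨expI ((1 / 2 : ℝ) • A), expI_mem_unitary hB, ?_⟩
  rw [← expI_transpose, transpose_smul, hA.2.1, ← h, expI, expI,
    ← Matrix.exp_add_of_commute _ _ (Commute.refl _)]
  congr 1
  rw [← smul_add, ← add_smul]
  norm_num

/-- The involution conjugates the hermitian product, which is therefore real on fixed vectors.
Writing `S = W Wᵀ`, the plane is the real span of the columns of `W`, and `det W` is real because
its square is 1. -/
theorem isSpecialLagrangian_fixedPlane {S : Matrix (Fin n) (Fin n) ℂ}
    (hS : S ∈ SymUnitary (Fin n)) : IsSpecialLagrangian (fixedPlane S) := by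
  obtain ⟨W, hW, rfl⟩ := exists_unitary_mul_transpose hS
  refine ⟨finrank_fixedPlane hW, fun u hu v hv => ?_, fun v hv => ?_⟩
  · rw [mem_fixedPlane] at hu hv
    have h := inner_antiMap hS.1 u v
    rw [hu, hv] at h
    exact Complex.conj_eq_iff_im.mp h.symm
  · have hx (i : Fin n) : ∃ x : Fin n → ℝ, realColumns W x = v i := by
      have := hv i
      rwa [← range_realColumns hW] at this
    choose x hx using hx
    have h1 : (Matrix.of fun i j => v i j) = (Matrix.of x).map Complex.ofRealHom * Wᵀ := by
      ext i j
      rw [of_apply, ← hx i, realColumns_apply, Matrix.mul_apply]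
      simp [mulVec, dotProduct, mul_comm]
    have hdet : W.det * W.det = 1 := by
      have := hS.2.2
      rwa [det_mul, det_transpose] at this
    have hdet' : (W.det).im = 0 := by
      rcases mul_self_eq_one_iff.mp hdet with h | h <;> simp [h]
    have h2 : ((Matrix.of x).map Complex.ofRealHom).det = ((Matrix.of x).det : ℂ) :=
      (RingHom.map_det Complex.ofRealHom (Matrix.of x)).symm
    rw [stdVolume, h1, det_mul, det_transpose, h2, Complex.mul_im, hdet', Complex.ofReal_im]
    simp

/-- On a Lagrangian plane a real orthonormal basis is also hermitian orthonormal, so it gives a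
unitary matrix `W`. The volume condition makes `det W` real, hence `±1`, and `W Wᵀ` is the required
matrix. -/
theorem IsSpecialLagrangian.exists_eq_fixedPlane {V : Submodule ℝ (Cn n)}
    (hV : IsSpecialLagrangian V) : ∃ S ∈ SymUnitary (Fin n), fixedPlane S = V := by
  let b : OrthonormalBasis (Fin n) ℝ V :=
    (stdOrthonormalBasis ℝ V).reindex (finCongr hV.finrank_eq)
  have hinner (i j : Fin n) : inner ℂ (b i : Cn n) (b j : Cn n) = if i = j then 1 else 0 := by
    have h1 := b.inner_eq_ite i j
    rw [Submodule.coe_inner, real_inner_eq_re] at h1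
    have h2 := hV.omega_eq_zero _ (b i).2 _ (b j).2
    apply Complex.ext
    · rw [h1]; split_ifs <;> simp
    · rw [show (inner ℂ (b i : Cn n) (b j : Cn n) : ℂ).im = 0 from h2]; split_ifs <;> simp
  let W : Matrix (Fin n) (Fin n) ℂ := Matrix.of fun p q => (b q : Cn n) p
  have hst : star W * W = 1 := by
    ext p q
    have h := hinner p q
    rw [PiLp.inner_apply] at h
    rw [Matrix.mul_apply, Matrix.one_apply, ← h]
    simp [W, mul_comm]
  have hW : W ∈ unitary (Matrix (Fin n) (Fin n) ℂ) := by
    rw [Unitary.mem_iff]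
    exact ⟨hst, mul_eq_one_comm.mp hst⟩
  have hdet : W.det * W.det = 1 := by
    have h1 : (W.det).im = 0 := by
      have := hV.im_volume_eq_zero (fun i => b i) fun i => (b i).2
      rw [stdVolume, ← det_transpose] at this
      exact this
    have h2 : star W.det * W.det = 1 := by
      rw [← det_conjTranspose, ← det_mul, ← star_eq_conjTranspose, hst, det_one]
    rwa [show star W.det = W.det from Complex.conj_eq_iff_im.mpr h1] at h2
  refine ⟨W * Wᵀ, ⟨mul_mem hW (transpose_mem_unitary hW), ?_, ?_⟩, ?_⟩
  · rw [transpose_mul, transpose_transpose]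
  · rw [det_mul, det_transpose, hdet]
  · refine Submodule.eq_of_le_of_finrank_eq ?_ ?_
    · rw [← range_realColumns hW]
      rintro _ ⟨x, rfl⟩
      have : realColumns W x = ∑ i, x i • (b i : Cn n) := by
        ext p
        rw [realColumns_apply]
        simp [mulVec, dotProduct, W, mul_comm]
      rw [this]
      exact V.sum_mem fun i _ => V.smul_mem _ (b i).2
    · rw [finrank_fixedPlane hW, hV.finrank_eq]

/-- The special Lagrangian plane of a symmetric special unitary matrix. -/
noncomputable def toSLG (S : SymUnitary (Fin n)) : SLG n :=
  ⟨fixedPlane S.1, isSpecialLagrangian_fixedPlane S.2⟩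

/-- The matrix that is recovered from the orthogonal projection onto `fixedPlane S`. -/
noncomputable def projMatrix (L : Cn n →L[ℝ] Cn n) : Matrix (Fin n) (Fin n) ℂ :=
  Matrix.of fun i j => (2 * L (EuclideanSpace.single j 1) i - EuclideanSpace.single j (1 : ℂ) i)

theorem continuous_projMatrix : Continuous (projMatrix (n := n)) := by
  refine continuous_matrix fun i j => ?_
  have h : Continuous fun L : Cn n →L[ℝ] Cn n => L (EuclideanSpace.single j 1) := by fun_prop
  have h2 : Continuous fun L : Cn n →L[ℝ] Cn n => L (EuclideanSpace.single j 1) i :=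
    (EuclideanSpace.proj (𝕜 := ℂ) i).continuous.comp h
  exact (continuous_const.mul h2).sub continuous_const

/-- Twice the projection minus the identity is `antiMap S`, and conjugation fixes the standard basis
vectors, so their images are the columns of `S`. -/
theorem projMatrix_starProjection {S : Matrix (Fin n) (Fin n) ℂ} (hS : S ∈ SymUnitary (Fin n)) :
    projMatrix (fixedPlane S).starProjection = S := by
  ext i j
  rw [starProjection_fixedPlane hS, projMatrix, of_apply]
  have h1 : star (EuclideanSpace.single j (1 : ℂ)).ofLp = Pi.single j 1 := by
    ext k; by_cases h : k = j <;> simp [h]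
  have h2 : antiMap S (EuclideanSpace.single j 1) i = S i j := by
    rw [antiMap_apply, h1]
    simp
  simp only [_root_.smul_apply, _root_.add_apply,
    ContinuousLinearMap.id_apply, PiLp.smul_apply, PiLp.add_apply, h2, Complex.real_smul]
  push_cast
  ring

theorem continuous_antiMap : Continuous (antiMap : Matrix (Fin n) (Fin n) ℂ → _) := by
  let L : Matrix (Fin n) (Fin n) ℂ →ₗ[ℝ] Cn n →L[ℝ] Cn n :=
    { toFun := antiMap
      map_add' := fun S T => by
        ext1 v
        rw [_root_.add_apply, antiMap_apply, antiMap_apply, antiMap_apply, add_mulVec]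
        rfl
      map_smul' := fun c S => by
        ext1 v
        rw [_root_.smul_apply, antiMap_apply, antiMap_apply, smul_mulVec]
        rfl }
  exact L.continuous_of_finiteDimensional

/-- The special Lagrangian Grassmannian is homeomorphic to the space of symmetric special unitary
matrices. -/
noncomputable def symUnitaryHomeomorphSLG (n : ℕ) : SymUnitary (Fin n) ≃ₜ SLG n :=
  have hP : Continuous fun V : SLG n => V.1.starProjection := continuous_induced_dom
  have hcont : Continuous (toSLG (n := n)) := by
    refine continuous_induced_rng.mpr ?_
    have h : (fun V : SLG n => V.1.starProjection) ∘ toSLG =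
        fun S => (1 / 2 : ℝ) • (ContinuousLinearMap.id ℝ (Cn n) + antiMap S.1) :=
      funext fun S => starProjection_fixedPlane S.2
    rw [h]
    exact (continuous_const_smul _).comp
      (continuous_const.add (continuous_antiMap.comp continuous_subtype_val))
  have hval : (projMatrix ∘ fun V : SLG n => V.1.starProjection) ∘ toSLG = Subtype.val :=
    funext fun S => projMatrix_starProjection S.2
  have hind : Topology.IsInducing (toSLG (n := n)) := by
    refine .of_comp hcont (continuous_projMatrix.comp hP) ?_
    rw [hval]
    exact .subtypeVal
  have hbij : Function.Bijective (toSLG (n := n)) := by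
    constructor
    · intro S T h
      have := congrArg (projMatrix ∘ fun V : SLG n => V.1.starProjection) h
      exact Subtype.ext ((congrFun hval S).symm.trans (this.trans (congrFun hval T)))
    · rintro ⟨V, hV⟩
      obtain ⟨S, hS, rfl⟩ := hV.exists_eq_fixedPlane
      exact ⟨⟨S, hS⟩, rfl⟩
  (Equiv.ofBijective _ hbij).toHomeomorphOfIsInducing hind

theorem fixedPlane_inf_eq_bot_iff {S T : Matrix (Fin n) (Fin n) ℂ} (hS : S ∈ SymUnitary (Fin n))
    (hT : T ∈ SymUnitary (Fin n)) : fixedPlane S ⊓ fixedPlane T = ⊥ ↔ (S - T).det ≠ 0 := by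
  constructor
  · intro h hdet
    obtain ⟨w, hw0, hw⟩ := Matrix.exists_mulVec_eq_zero_iff.mpr hdet
    have hw' : S *ᵥ w = T *ᵥ w := by rwa [sub_mulVec, sub_eq_zero] at hw
    -- If `S w = T w`, then `S (z w)` plus the conjugate of `z w` is fixed by both involutions. Its
    -- vanishing for `z = 1` and for `z = i` forces `w = 0`.
    have key (z : ℂ) : S *ᵥ (z • w) + star (z • w) = 0 := by
      have hz : S *ᵥ (z • w) = T *ᵥ (z • w) := by rw [mulVec_smul, mulVec_smul, hw']
      have hmem (R : Matrix (Fin n) (Fin n) ℂ) (hR : R ∈ SymUnitary (Fin n)) :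
          WithLp.toLp 2 (R *ᵥ (z • w) + star (z • w)) ∈ fixedPlane R := by
        rw [mem_fixedPlane, antiMap_apply]
        congr 1
        simp only [star_add, star_star, mulVec_add, star_mulVec', mulVec_mulVec,
          mul_map_star_eq_one hR, one_mulVec, add_comm]
      have h1 : WithLp.toLp 2 (S *ᵥ (z • w) + star (z • w)) ∈ fixedPlane S ⊓ fixedPlane T :=
        ⟨hmem S hS, by rw [hz]; exact hmem T hT⟩
      rw [h, Submodule.mem_bot] at h1
      exact congrArg WithLp.ofLp h1
    have h1 := key 1
    have h2 := key I
    rw [one_smul] at h1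
    rw [mulVec_smul, eq_neg_of_add_eq_zero_left h1] at h2
    apply hw0
    ext i
    have h3 := congrFun h2 i
    simp only [Pi.add_apply, Pi.smul_apply, Pi.neg_apply, Pi.star_apply, smul_eq_mul, star_mul',
      Complex.star_def, Complex.conj_I, Pi.zero_apply] at h3
    have h4 : -2 * I * (starRingEnd ℂ) (w i) = 0 := by linear_combination h3
    simpa using h4
  · intro hdet
    rw [Submodule.eq_bot_iff]
    rintro v ⟨h1, h2⟩
    have h1' : S *ᵥ star v.ofLp = v.ofLp := congrArg WithLp.ofLp (mem_fixedPlane.mp h1)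
    have h2' : T *ᵥ star v.ofLp = v.ofLp := congrArg WithLp.ofLp (mem_fixedPlane.mp h2)
    have h3 : (S - T) *ᵥ star v.ofLp = 0 := by rw [sub_mulVec, h1', h2', sub_self]
    have h4 := Matrix.eq_zero_of_mulVec_eq_zero hdet h3
    have h5 : v.ofLp = 0 := star_eq_zero.mp h4
    exact (WithLp.ofLp_eq_zero 2).mp h5

end SpecialLagrangianModel

/-! ### Relative angles of transverse pairs and the two components. -/

section TransversePairs

open Matrix Complex

variable {n : Type*} [Fintype n] [DecidableEq n]

variable (n) in
/-- Pairs of symmetric special unitary matrices with invertible difference. -/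
abbrev TransversePairs : Type _ :=
  {p : SymUnitary n × SymUnitary n // (p.1.1 - p.2.1).det ≠ 0}

/-- The unitary matrix that measures the relative position of two Lagrangian planes. -/
def relMatrix (p : TransversePairs n) : Matrix n n ℂ := -(p.1.2.1 * star p.1.1.1)

/-- The hermitian matrix of relative angles of two transverse planes, shifted by `-π`. -/
noncomputable def relArg (p : TransversePairs n) : Matrix n n ℂ := argU (relMatrix p)

theorem relMatrix_mem_unitary (p : TransversePairs n) :
    relMatrix p ∈ unitary (Matrix n n ℂ) := by
  have h : p.1.2.1 * star p.1.1.1 ∈ unitary (Matrix n n ℂ) :=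
    mul_mem p.1.2.2.1 (Unitary.star_mem p.1.1.2.1)
  rw [relMatrix, Unitary.mem_iff] at *
  simpa using h

theorem norm_relMatrix_sub_one_lt (p : TransversePairs n) : ‖relMatrix p - 1‖ < 2 := by
  rw [norm_sub_one_lt_two_iff_det (relMatrix_mem_unitary p)]
  have h : relMatrix p + 1 = (p.1.1.1 - p.1.2.1) * star p.1.1.1 := by
    rw [sub_mul, Unitary.mul_star_self_of_mem p.1.1.2.1, relMatrix]
    abel
  rw [h, det_mul]
  refine mul_ne_zero p.2 ?_
  rw [star_eq_conjTranspose, det_conjTranspose, p.1.1.2.2.2]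
  simp

theorem expI_relArg (p : TransversePairs n) : expI (relArg p) = relMatrix p :=
  expI_argU (relMatrix_mem_unitary p) (norm_relMatrix_sub_one_lt p)

theorem relArg_isHermitian (p : TransversePairs n) : (relArg p).IsHermitian :=
  argU_isHermitian _

theorem norm_relArg_lt (p : TransversePairs n) : ‖relArg p‖ < Real.pi :=
  norm_argU_lt (relMatrix_mem_unitary p) (norm_relMatrix_sub_one_lt p)

theorem relMatrix_mul (p : TransversePairs n) : relMatrix p * p.1.1.1 = -p.1.2.1 := by
  rw [relMatrix, neg_mul, mul_assoc, Unitary.star_mul_self_of_mem p.1.1.2.1, mul_one]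

/-- This expresses the symmetry of the second matrix of the pair. For a fixed first matrix it is a
linear condition on the logarithm, which is what makes `relDomain` convex. -/
theorem relArg_transpose (p : TransversePairs n) :
    (relArg p)ᵀ = star p.1.1.1 * relArg p * p.1.1.1 := by
  have hS := p.1.1.2.1
  have hst : (star p.1.1.1)ᵀ = star p.1.1.1 := by
    have h1 : (star p.1.1.1)ᵀ = star (p.1.1.1)ᵀ := rfl
    rw [h1, p.1.1.2.2.1]
  have h : (relMatrix p)ᵀ = star p.1.1.1 * relMatrix p * star (star p.1.1.1) := by
    rw [star_star, mul_assoc, relMatrix_mul, relMatrix, transpose_neg, transpose_mul, hst,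
      p.1.2.2.2.1, mul_neg]
  rw [relArg, ← argU_transpose (relMatrix_mem_unitary p) (norm_relMatrix_sub_one_lt p), h,
    argU_conj (Unitary.star_mem hS) (relMatrix_mem_unitary p) (norm_relMatrix_sub_one_lt p),
    star_star]

theorem continuous_relArg : Continuous (relArg : TransversePairs n → Matrix n n ℂ) := by
  have h : Continuous (relMatrix : TransversePairs n → Matrix n n ℂ) := by
    unfold relMatrix
    fun_prop
  exact continuousOn_argU.comp_continuous h
    fun p => ⟨relMatrix_mem_unitary p, norm_relMatrix_sub_one_lt p⟩

/-- The interchange of the two members of a pair. -/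
def TransversePairs.swap (p : TransversePairs n) : TransversePairs n :=
  ⟨(p.1.2, p.1.1), by
    have := p.2
    rw [← neg_sub, det_neg]
    exact mul_ne_zero (pow_ne_zero _ (by simp)) this⟩

theorem relArg_swap (p : TransversePairs n) : relArg p.swap = -relArg p := by
  have h : relMatrix p.swap = star (relMatrix p) := by
    simp [relMatrix, TransversePairs.swap]
  rw [relArg, h, argU_star (relMatrix_mem_unitary p) (norm_relMatrix_sub_one_lt p), relArg]

/-- The number `π` for `true` and `-π` for `false`. -/
noncomputable def signedPi (b : Bool) : ℝ := if b then Real.pi else -Real.pi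

/-- The relative matrix has determinant `(-1)³ = -1`, so the trace is an odd multiple of `π`, while
three eigenvalues in `(-π, π)` bound it strictly by `3π`. -/
theorem trace_relArg (p : TransversePairs (Fin 3)) :
    (relArg p).trace.re = Real.pi ∨ (relArg p).trace.re = -Real.pi := by
  have hA := relArg_isHermitian p
  have hpi := Real.pi_pos
  have h1 := abs_trace_re_lt hA (norm_relArg_lt p)
  have h2 := det_expI hA
  have h3 : (relMatrix p).det = -1 := by
    rw [relMatrix, det_neg, det_mul, star_eq_conjTranspose, det_conjTranspose, p.1.1.2.2.2,
      p.1.2.2.2.2]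
    simp; norm_num
  rw [expI_relArg, h3, hA.trace_eq_re, ← Complex.exp_pi_mul_I, eq_comm,
    Complex.exp_eq_exp_iff_exists_int] at h2
  obtain ⟨m, hm⟩ := h2
  set t := (relArg p).trace.re
  have h4 : t = Real.pi + m * (2 * Real.pi) := by
    have : (t : ℂ) * I = (Real.pi + m * (2 * Real.pi) : ℂ) * I := by rw [hm]; ring
    have := mul_right_cancel₀ I_ne_zero this
    exact_mod_cast this
  rw [h4, abs_lt] at h1
  simp only [Fintype.card_fin, Nat.cast_ofNat] at h1
  have h5 : (m : ℝ) < 1 := by nlinarith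
  have h6 : (-2 : ℝ) < m := by nlinarith
  have h7 : m < 1 := by exact_mod_cast h5
  have h8 : -2 < m := by exact_mod_cast h6
  obtain rfl | rfl : m = 0 ∨ m = -1 := by omega
  · left; rw [h4]; simp
  · right; rw [h4]; push_cast; ring

/-- The sign of the total relative angle, which distinguishes the two components. -/
noncomputable def pairSign (p : TransversePairs (Fin 3)) : Bool :=
  decide (0 < (relArg p).trace.re)

theorem pairSign_eq_iff {p : TransversePairs (Fin 3)} {b : Bool} :
    pairSign p = b ↔ (relArg p).trace = signedPi b := by
  have hpi := Real.pi_pos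
  rw [(relArg_isHermitian p).trace_eq_re, Complex.ofReal_inj]
  have h1 : Real.pi ≠ -Real.pi := by linarith
  rcases trace_relArg p with h | h <;> cases b <;>
    simp [pairSign, signedPi, h, hpi, hpi.le, h1, h1.symm]

theorem continuous_pairSign : Continuous pairSign := by
  have htr : Continuous fun p : TransversePairs (Fin 3) => (relArg p).trace.re :=
    Complex.continuous_re.comp continuous_relArg.matrix_trace
  have hpi := Real.pi_pos
  rw [continuous_discrete_rng]
  rintro (_ | _)
  · have : pairSign ⁻¹' {false} = {p | (relArg p).trace.re < 0} := by
      ext p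
      rcases trace_relArg p with h | h <;> simp [pairSign, h, hpi, hpi.le]
    rw [this]
    exact isOpen_lt htr continuous_const
  · have : pairSign ⁻¹' {true} = {p | 0 < (relArg p).trace.re} := by
      ext p
      simp [pairSign]
    rw [this]
    exact isOpen_lt continuous_const htr

theorem pairSign_swap (p : TransversePairs (Fin 3)) : pairSign p.swap = !pairSign p := by
  have hpi := Real.pi_pos
  rcases trace_relArg p with h | h <;> simp [pairSign, relArg_swap, h, hpi, hpi.le]

/-- The admissible matrices of relative angles at a given first plane. -/
def relDomain (b : Bool) (S : Matrix n n ℂ) : Set (Matrix n n ℂ) :=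
  {C | C.IsHermitian ∧ ‖C‖ < Real.pi ∧ Cᵀ = star S * C * S ∧ C.trace = signedPi b}

theorem convex_relDomain (b : Bool) (S : Matrix n n ℂ) :
    Convex ℝ (relDomain b S) := by
  rintro A ⟨hA, hs, ht, hr⟩ B ⟨hB, hs', ht', hr'⟩ x y hx hy hxy
  refine ⟨(hA.smul (IsSelfAdjoint.all x)).add (hB.smul (IsSelfAdjoint.all y)), ?_, ?_, ?_⟩
  · exact mem_ball_zero_iff.mp ((convex_ball (0 : Matrix n n ℂ) Real.pi)
      (mem_ball_zero_iff.mpr hs) (mem_ball_zero_iff.mpr hs') hx hy hxy)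
  · rw [transpose_add, transpose_smul, transpose_smul, ht, ht', mul_add, add_mul, mul_smul_comm,
      mul_smul_comm, smul_mul_assoc, smul_mul_assoc]
  · rw [trace_add, trace_smul, trace_smul, hr, hr', ← add_smul, hxy, one_smul]

/-- The transpose condition on `C` gives the symmetry of `-(expI C * S)`, and the trace `±π` gives
`det (expI C) = -1`, which cancels the sign `(-1)³`. -/
theorem neg_expI_mul_mem_symUnitary {b : Bool} {S C : Matrix (Fin 3) (Fin 3) ℂ}
    (hS : S ∈ SymUnitary (Fin 3)) (hC : C ∈ relDomain b S) :
    -(expI C * S) ∈ SymUnitary (Fin 3) := by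
  obtain ⟨h1, h2, h3, h4⟩ := hC
  refine ⟨?_, ?_, ?_⟩
  · have := mul_mem (expI_mem_unitary h1) hS.1
    rw [Unitary.mem_iff] at this ⊢
    simpa using this
  · have h5 : (expI C)ᵀ = star S * expI C * S := by
      rw [← expI_transpose, h3]
      have := expI_conj (Unitary.star_mem hS.1) C
      rwa [star_star] at this
    rw [transpose_neg, transpose_mul, hS.2.1, h5, ← mul_assoc, ← mul_assoc,
      Unitary.mul_star_self_of_mem hS.1, one_mul]
  · rw [det_neg, det_mul, hS.2.2, det_expI h1, h4]
    have : Complex.exp ((signedPi b : ℂ) * I) = -1 := by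
      cases b
      · simp only [signedPi, Bool.false_eq_true, if_false]
        rw [Complex.ofReal_neg, neg_mul, Complex.exp_neg, Complex.exp_pi_mul_I]
        norm_num
      · simp only [signedPi, if_true]
        exact Complex.exp_pi_mul_I
    rw [this]
    simp; norm_num

/-- The pair with a given first member and given relative angles. -/
noncomputable def pairOf {b : Bool} (S : SymUnitary (Fin 3)) (C : Matrix (Fin 3) (Fin 3) ℂ)
    (hC : C ∈ relDomain b S.1) : TransversePairs (Fin 3) :=
  ⟨(S, ⟨-(expI C * S.1), neg_expI_mul_mem_symUnitary S.2 hC⟩), by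
    have h : S.1 - -(expI C * S.1) = (expI C + 1) * S.1 := by rw [add_mul, one_mul]; abel
    simp only [h, det_mul, S.2.2.2, mul_one]
    exact (norm_sub_one_lt_two_iff_det (expI_mem_unitary hC.1)).mp
      (norm_expI_sub_one_lt hC.1 hC.2.1)⟩

theorem relArg_pairOf {b : Bool} (S : SymUnitary (Fin 3)) (C : Matrix (Fin 3) (Fin 3) ℂ)
    (hC : C ∈ relDomain b S.1) : relArg (pairOf S C hC) = C := by
  have h : relMatrix (pairOf S C hC) = expI C := by
    rw [relMatrix, pairOf]
    simp only
    rw [neg_mul, neg_neg, mul_assoc, Unitary.mul_star_self_of_mem S.2.1, mul_one]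
  rw [relArg, h, argU_expI hC.1 hC.2.1]

theorem relArg_mem_relDomain {p : TransversePairs (Fin 3)} {b : Bool} (hp : pairSign p = b) :
    relArg p ∈ relDomain b p.1.1.1 :=
  ⟨relArg_isHermitian p, norm_relArg_lt p, relArg_transpose p, pairSign_eq_iff.mp hp⟩

theorem pairOf_relArg {p : TransversePairs (Fin 3)} {b : Bool} (hp : pairSign p = b) :
    pairOf p.1.1 (relArg p) (relArg_mem_relDomain hp) = p := by
  refine Subtype.ext (Prod.ext rfl (Subtype.ext ?_))
  change -(expI (relArg p) * p.1.1.1) = p.1.2.1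
  rw [expI_relArg, relMatrix_mul, neg_neg]

theorem smul_one_mem_relDomain (b : Bool) (S : SymUnitary (Fin 3)) :
    ((signedPi b / 3 : ℝ) : ℂ) • 1 ∈ relDomain b S.1 := by
  refine ⟨real_smul_one_isHermitian _, ?_, ?_, ?_⟩
  · have hpi := Real.pi_pos
    rw [norm_smul, norm_one, mul_one, Complex.norm_real, Real.norm_eq_abs, abs_lt]
    cases b <;> simp only [signedPi, if_true, Bool.false_eq_true, if_false] <;>
      constructor <;> linarith
  · rw [mul_smul_comm, mul_one, smul_mul_assoc, Unitary.star_mul_self_of_mem S.2.1]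
    simp
  · rw [real_smul_one_trace]
    push_cast [Fintype.card_fin]
    ring

/-- Forgetting the second plane is a homotopy equivalence onto `SymUnitary (Fin 3)`: its inverse
gives every plane the scalar relative angle `signedPi b / 3`, and straight segments in `relDomain b
S` provide the homotopy. -/
theorem isSimplyConnected_pairSign_preimage (b : Bool) : IsSimplyConnected (pairSign ⁻¹' {b}) := by
  have hmk {S : SymUnitary (Fin 3)} {C : Matrix (Fin 3) (Fin 3) ℂ} (hC : C ∈ relDomain b S.1) :
      pairOf S C hC ∈ pairSign ⁻¹' {b} := by
    change pairSign _ = b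
    rw [pairSign_eq_iff, relArg_pairOf, hC.2.2.2]
  let fwd : C(pairSign ⁻¹' {b}, SymUnitary (Fin 3)) :=
    ⟨fun p => p.1.1.1, by fun_prop⟩
  let bwd : C(SymUnitary (Fin 3), pairSign ⁻¹' {b}) :=
    ⟨fun S => ⟨pairOf S _ (smul_one_mem_relDomain b S), hmk _⟩, by
      refine Continuous.subtype_mk (Continuous.subtype_mk (continuous_id.prodMk
        (Continuous.subtype_mk ?_ _)) _) _
      exact (continuous_const.mul continuous_subtype_val).neg⟩
  have hseg (t : unitInterval) (p : pairSign ⁻¹' {b}) :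
      (1 - t : ℝ) • ((signedPi b / 3 : ℝ) : ℂ) • (1 : Matrix (Fin 3) (Fin 3) ℂ) +
        (t : ℝ) • relArg p.1 ∈ relDomain b p.1.1.1.1 :=
    convex_relDomain b _ (smul_one_mem_relDomain b _) (relArg_mem_relDomain p.2)
      (sub_nonneg.mpr t.2.2) t.2.1 (by ring)
  let H : ContinuousMap.Homotopy (bwd.comp fwd) (ContinuousMap.id (pairSign ⁻¹' {b})) :=
    { toFun := fun x => ⟨pairOf x.2.1.1.1 _ (hseg x.1 x.2), hmk _⟩
      continuous_toFun := by
        have h1 : Continuous fun x : unitInterval × (pairSign ⁻¹' {b}) => x.2.1.1.1 := by fun_prop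
        refine Continuous.subtype_mk (Continuous.subtype_mk (h1.prodMk
          (Continuous.subtype_mk ?_ _)) _) _
        refine (Continuous.mul (continuous_expI.comp (Continuous.add ?_ ?_))
          (continuous_subtype_val.comp h1)).neg
        · exact Continuous.smul (f := fun x : unitInterval × (pairSign ⁻¹' {b}) => (1 - x.1 : ℝ))
            (by fun_prop) continuous_const
        · exact Continuous.smul (f := fun x : unitInterval × (pairSign ⁻¹' {b}) => (x.1 : ℝ))
            (by fun_prop) (continuous_relArg.comp (continuous_subtype_val.comp continuous_snd))
      map_zero_left := fun p => by
        refine Subtype.ext (Subtype.ext (Prod.ext rfl (Subtype.ext ?_)))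
        change -(expI _ * p.1.1.1.1) = -(expI _ * p.1.1.1.1)
        simp
      map_one_left := fun p => by
        refine Subtype.ext (Eq.trans ?_ (pairOf_relArg p.2))
        refine Subtype.ext (Prod.ext rfl (Subtype.ext ?_))
        change -(expI _ * p.1.1.1.1) = -(expI _ * p.1.1.1.1)
        simp }
  let e : ContinuousMap.HomotopyEquiv (pairSign ⁻¹' {b}) (SymUnitary (Fin 3)) :=
    { toFun := fwd
      invFun := bwd
      left_inv := ⟨H⟩
      right_inv := by
        have : fwd.comp bwd = ContinuousMap.id _ := by ext1 S; rfl
        rw [this] }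
  have := simplyConnectedSpace_symUnitary
  exact e.simplyConnectedSpace

/-- The space of transverse special Lagrangian planes in terms of symmetric unitary matrices. -/
noncomputable def M0HomeomorphTransversePairs (n : ℕ) : TransversePairs (Fin n) ≃ₜ M0 n :=
  ((symUnitaryHomeomorphSLG n).prodCongr (symUnitaryHomeomorphSLG n)).subtype fun p =>
    (fixedPlane_inf_eq_bot_iff p.1.2 p.2.2).symm

end TransversePairs

theorem theorem3p6 :
    (Nat.card (ConnectedComponents (M0 3)) = 2 ∧
      ∀ p : M0 3, SimplyConnectedSpace (connectedComponent p)) ∧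
    (ConnectedSpace (M0Tilde 3) ∧ SimplyConnectedSpace (M0Tilde 3)) := by
  let e := M0HomeomorphTransversePairs 3
  let f : M0 3 → Bool := pairSign ∘ e.symm
  have hf : Continuous f := continuous_pairSign.comp e.symm.continuous
  have hsc (b : Bool) : IsSimplyConnected (f ⁻¹' {b}) := by
    rw [Set.preimage_comp, e.symm.isSimplyConnected_preimage]
    exact isSimplyConnected_pairSign_preimage b
  have hc (b : Bool) : IsConnected (f ⁻¹' {b}) := (hsc b).isPathConnected.isConnected
  -- Interchanging the planes replaces `relArg` by its negative, so the sign of its trace flips.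
  have hswap (p : M0 3) : f p.swap = !f p := by
    have h : e.symm p.swap = (e.symm p).swap := by
      rw [e.symm_apply_eq]
      obtain ⟨q, rfl⟩ := e.surjective p
      rw [e.symm_apply_apply]
      rfl
    change pairSign (e.symm p.swap) = _
    rw [h, pairSign_swap]
    rfl
  have hswap_cont : Continuous (M0.swap : M0 3 → M0 3) := by
    unfold M0.swap
    fun_prop
  have hq : SimplyConnectedSpace (M0Tilde 3) :=
    (fibreHomeomorphQuotient hf hswap_cont hswap (M0.swapSetoid 3) fun _ _ => Iff.rfl
      ).symm.toHomotopyEquiv.simplyConnectedSpace_iff.mpr (hsc true)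
  refine ⟨⟨card_connectedComponents_eq_two hf hc, fun p => ?_⟩, inferInstance, hq⟩
  rw [connectedComponent_eq_preimage hf hc]
  exact hsc (f p)
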